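/- Let $U:\mathbb R\to\mathbb R$ be a double-well potential, that is, a $C^2$ Morse function ($U'(x)=0$ implies $U''(x)\neq 0$) whose local minima are exactly $x_0$ and $x_2$ and whose only local maximum is $x_1$, with $x_0<x_1<x_2$, which is convex on $(-\infty,x_0]$ and on $[x_2,\infty)$ and satisfies $U(x)\to\infty$ as $|x|\to\infty$. For $\varepsilon>0$ let $(X^\varepsilon_t,Y^\varepsilon_t)_{t\ge 0}$ be the velocity jump process on $\mathbb R\times\{\pm1\}$ started at $(x_0,-1)$ with generator $$Lf(x,y)=y\,\partial_x f(x,y)+\frac1\varepsilon\big(yU'(x)\big)_+\big(f(x,-y)-f(x,y)\big),\qquad (g)_+=\max(g,0),$$ constructed as follows from independent exponential variables $(E_k)_{k\ge0}$ of mean $1$: $T_0=0$, $(X_0^\varepsilon,Y_0^\varepsilon)=(x_0,-1)$, and for every $i\ge 0$ $$T_{i+1}=\inf\Big\{t>T_i:\ \int_{T_i}^t\frac1\varepsilon\Big(Y^\varepsilon_{T_i}U'\big(X^\varepsilon_{T_i}+Y^\varepsilon_{T_i}(s-T_i)\big)\Big)_+ds\ \ge E_i\Big\},$$ $X^\varepsilon_t=X^\varepsilon_{T_i}+Y^\varepsilon_{T_i}(t-T_i)$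 for $t\in[T_i,T_{i+1}]$, $Y^\varepsilon_t=Y^\varepsilon_{T_i}$ for $t\in[T_i,T_{i+1})$, and $Y^\varepsilon_{T_{i+1}}=-Y^\varepsilon_{T_i}$. (The variables $E_k$, and the probability space on which they live, may depend on $\varepsilon$.) Let $\tau=\tau_\varepsilon=\inf\{t>0:\ X^\varepsilon_t=x_1\}\in[0,\infty]$. Then $\mathbb E[\tau]<\infty$ for every $\varepsilon>0$; as $\varepsilon\to0$, $\varepsilon>0$, $$\mathbb E[\tau]=\sqrt{\frac{8\pi\varepsilon}{U''(x_0)}}\;e^{\frac{U(x_1)-U(x_0)}{\varepsilon}}\,\big(1+o(1)\big);$$ and for every $t\ge0$ $$\mathbb P\big(\tau\ge t\,\mathbb E[\tau]\big)\ \longrightarrow\ e^{-t}\qquad(\varepsilon\to0),$$ i.e. $\tau/\mathbb E[\tau]$ converges in law to an exponential variable of mean $1$. -/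

import Mathlib

open MeasureTheory ProbabilityTheory Filter Topology Set
open scoped ENNReal

/-- A one-dimensional double-well potential: a Morse function (all critical points are
non-degenerate) whose local minima are exactly `x₀` and `x₂`, whose only local maximum is
`x₁ ∈ (x₀, x₂)`, which is convex outside `(x₀, x₂)` and tends to infinity at `±∞`. -/
structure IsDoubleWell (U : ℝ → ℝ) (x₀ x₁ x₂ : ℝ) : Prop where
  contDiff : ContDiff ℝ 2 U
  morse : ∀ x, deriv U x = 0 → deriv (deriv U) x ≠ 0
  lt_saddle : x₀ < x₁
  saddle_lt : x₁ < x₂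
  isLocalMin_iff : ∀ x, IsLocalMin U x ↔ x = x₀ ∨ x = x₂
  isLocalMax_iff : ∀ x, IsLocalMax U x ↔ x = x₁
  convexOn_left : ConvexOn ℝ (Iic x₀) U
  convexOn_right : ConvexOn ℝ (Ici x₂) U
  tendsto_atBot : Tendsto U atBot atTop
  tendsto_atTop : Tendsto U atTop atTop

/-- The minimal jump rate `(y U'(x))₊ / ε` at position `x` and velocity `y`. -/
noncomputable def minimalRate (U : ℝ → ℝ) (ε x y : ℝ) : ℝ :=
  max (y * deriv U x) 0 / ε

/-- The first time `t > s` at which the jump rate, integrated from time `s` along the ray issued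
from position `x` with velocity `y`, reaches `e`. (If the total integrated rate is infinite along
every ray, as is the case for the minimal rate of a potential that tends to infinity at `±∞`, then
the set below is never empty.) -/
noncomputable def nextJumpTime (rate : ℝ → ℝ → ℝ) (s x y e : ℝ) : ℝ :=
  sInf {t : ℝ | s < t ∧ e ≤ ∫ u in s..t, rate (x + y * (u - s)) y}

/-- The sequence `(Tᵢ, (X_{Tᵢ}, Y_{Tᵢ}))` of jump times and post-jump states of the velocity jump
process with the given rate, initial state `z₀` and clocks `e 0, e 1, …`: `T₀ = 0`, the process
moves at constant velocity until the integrated rate since `Tᵢ` reaches `e i`, and its velocity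
is then reversed. -/
noncomputable def jumpSkeleton (rate : ℝ → ℝ → ℝ) (z₀ : ℝ × ℝ) (e : ℕ → ℝ) : ℕ → ℝ × (ℝ × ℝ)
  | 0 => (0, z₀)
  | i + 1 =>
    let p := jumpSkeleton rate z₀ e i
    let t := nextJumpTime rate p.1 p.2.1 p.2.2 (e i)
    (t, (p.2.1 + p.2.2 * (t - p.1), -p.2.2))

/-- The number of jumps up to time `t`. -/
noncomputable def jumpCount (rate : ℝ → ℝ → ℝ) (z₀ : ℝ × ℝ) (e : ℕ → ℝ) (t : ℝ) : ℕ :=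
  sSup {i : ℕ | (jumpSkeleton rate z₀ e i).1 ≤ t}

/-- The state `(X_t, Y_t)` of the velocity jump process at time `t ≥ 0`. When the clocks are
independent standard exponential variables, this is the Markov process with generator
`L f (x, y) = y ∂ₓf (x, y) + rate x y * (f (x, -y) - f (x, y))`. -/
noncomputable def velocityJumpProcess (rate : ℝ → ℝ → ℝ) (z₀ : ℝ × ℝ) (e : ℕ → ℝ) (t : ℝ) :
    ℝ × ℝ :=
  let p := jumpSkeleton rate z₀ e (jumpCount rate z₀ e t)
  (p.2.1 + p.2.2 * (t - p.1), p.2.2)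

/-- `inf {t > 0 | x t = a}`, equal to `∞` if `a` is never hit. -/
noncomputable def firstHit (x : ℝ → ℝ) (a : ℝ) : ℝ≥0∞ :=
  ⨅ t ∈ {t : ℝ | 0 < t ∧ x t = a}, ENNReal.ofReal t

/-- The first time at which the velocity jump process with rate `(y U'(x))₊ / ε`, initial state
`(x₀, -1)` and clocks `e` has position `x₁`. -/
noncomputable def exitTime (U : ℝ → ℝ) (x₀ x₁ ε : ℝ) (e : ℕ → ℝ) : ℝ≥0∞ :=
  firstHit (fun t => (velocityJumpProcess (minimalRate U ε) (x₀, -1) e t).1) x₁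

/-! Only uphill motion is charged by the rate, so the path is explicit. From `x₀` the particle
climbs the left branch until `U` has risen by `ε * E (2j)`, at distance `a`, and slides back to `x₀`
without jumping. It then climbs to the right: if `ε * E (2j+1)` is below the barrier `h = U x₁ - U
x₀`, it turns at a distance `b < d = x₁ - x₀` and slides back; otherwise it reaches `x₁`. Hence `τ`
is a geometric sum of i.i.d. failed cycles `2a + 2b`, closed by `2a + d`, with success probability
`p = exp (-h/ε)` (`IsWellRate.firstHit_eq`, `exists_isGeometricSum`).

Mean. With `α = 𝔼 a` and `β = 𝔼 min(b, d)`, the failed right runs contribute `β - p d`, and summing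
a geometric series gives `𝔼 τ = (2α + 2β)/p - d`. The tail of `a` at `r` is `exp (-(U (x₀ - r) - U
x₀)/ε)`, and similarly on the right up to `d`; so `α` and `β` are Laplace integrals, both equivalent
to `σ √ε` with `σ = √(2π/U''(x₀))/2` (`tendsto_laplace`). The prefactor is `4σ √ε`.

Law. Decomposing over the first success, the characteristic function of `τ` at `s` is `A p
exp(isd)/(1 - A B)`, with `A = 𝔼 exp(2isa)` and `B = 𝔼[exp(2isb); failure]` (`integral_cexp_eq`).
For `s = t/𝔼 τ`, of order `p/√ε`, second-order terms are `O(p²/ε) = o(p)`; hence `A - 1 ≈ itp/2`, `B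
- 1 ≈ -p + itp/2`, `1 - A B ≈ p(1 - it)`, and the quotient tends to `1/(1 - it)`
(`tendsto_charFun_geometric`). Lévy's theorem concludes. -/

/-! ### Level times of an integrated intensity -/

/-- The first time at which the integral of `φ` from `0` reaches the level `e`. -/
noncomputable def levelTime (φ : ℝ → ℝ) (e : ℝ) : ℝ :=
  sInf {r : ℝ | 0 < r ∧ e ≤ ∫ u in (0 : ℝ)..r, φ u}

/-- Translation in time commutes with the infimum only for a nonempty set: `sInf ∅ = 0` is not
translated. -/
lemma nextJumpTime_eq_add_levelTime (rate : ℝ → ℝ → ℝ) (s x y e : ℝ)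
    (hne : ∃ r, 0 < r ∧ e ≤ ∫ u in (0 : ℝ)..r, rate (x + y * u) y) :
    nextJumpTime rate s x y e = s + levelTime (fun u => rate (x + y * u) y) e := by
  have hint : ∀ t, ∫ u in s..t, rate (x + y * (u - s)) y =
      ∫ u in (0 : ℝ)..(t - s), rate (x + y * u) y := fun t => by
    rw [intervalIntegral.integral_comp_sub_right (fun u => rate (x + y * u) y) s, sub_self]
  have hset : {t : ℝ | s < t ∧ e ≤ ∫ u in s..t, rate (x + y * (u - s)) y} =
      OrderIso.addLeft s '' {r : ℝ | 0 < r ∧ e ≤ ∫ u in (0 : ℝ)..r, rate (x + y * u) y} := by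
    ext t
    simp only [mem_ofPred_eq, hint, mem_image, OrderIso.addLeft_apply]
    constructor
    · rintro ⟨h1, h2⟩
      exact ⟨t - s, ⟨sub_pos.2 h1, h2⟩, by ring⟩
    · rintro ⟨r, ⟨h1, h2⟩, rfl⟩
      exact ⟨by linarith, by rwa [add_sub_cancel_left]⟩
  have hne' : {r : ℝ | 0 < r ∧ e ≤ ∫ u in (0 : ℝ)..r, rate (x + y * u) y}.Nonempty := hne
  rw [nextJumpTime, hset, levelTime, ← OrderIso.map_csInf' (OrderIso.addLeft s) hne'
    ⟨0, fun r hr => hr.1.le⟩]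
  rfl

lemma levelTime_nonneg (φ : ℝ → ℝ) (e : ℝ) : 0 ≤ levelTime φ e :=
  Real.sInf_nonneg fun _ hr => hr.1.le

/-- A continuous nonnegative intensity with infinite total mass on `[0, ∞)`. -/
structure IsIntensity (φ : ℝ → ℝ) : Prop where
  continuous : Continuous φ
  nonneg : ∀ u, 0 ≤ φ u
  tendsto : Tendsto (fun r => ∫ u in (0 : ℝ)..r, φ u) atTop atTop

namespace IsIntensity

variable {φ : ℝ → ℝ}

lemma monotone_integral (h : IsIntensity φ) : Monotone fun r => ∫ u in (0 : ℝ)..r, φ u := by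
  intro r s hrs
  have := intervalIntegral.integral_add_adjacent_intervals
    (h.continuous.intervalIntegrable 0 r) (h.continuous.intervalIntegrable r s) (μ := volume)
  have h2 : 0 ≤ ∫ u in r..s, φ u := intervalIntegral.integral_nonneg hrs fun u _ => h.nonneg u
  simp only
  linarith

lemma continuous_integral (h : IsIntensity φ) : Continuous fun r => ∫ u in (0 : ℝ)..r, φ u :=
  intervalIntegral.continuous_primitive (fun a b => h.continuous.intervalIntegrable a b) 0

lemma exists_level (h : IsIntensity φ) (e : ℝ) : ∃ r, 0 < r ∧ e ≤ ∫ u in (0 : ℝ)..r, φ u :=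
  ((eventually_gt_atTop 0).and (h.tendsto.eventually_ge_atTop e)).exists

/-- The infimum is attained because the integral is continuous and monotone. This Galois connection
is the only way in which level times are evaluated afterwards. -/
lemma levelTime_le_iff (h : IsIntensity φ) (e : ℝ) {r : ℝ} (hr : 0 ≤ r) :
    levelTime φ e ≤ r ↔ e ≤ ∫ u in (0 : ℝ)..r, φ u := by
  constructor
  · intro hle
    refine ge_of_tendsto (x := 𝓝[>] r)
      ((h.continuous_integral.tendsto r).mono_left nhdsWithin_le_nhds) ?_
    filter_upwards [self_mem_nhdsWithin] with s hs
    obtain ⟨t, ht, hts⟩ := exists_lt_of_csInf_lt (h.exists_level e) (lt_of_le_of_lt hle hs)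
    exact ht.2.trans (h.monotone_integral hts.le)
  · intro hle
    refine le_of_forall_gt_imp_ge_of_dense fun s hs => ?_
    exact csInf_le ⟨0, fun r hr => hr.1.le⟩
      ⟨hr.trans_lt hs, hle.trans (h.monotone_integral hs.le)⟩

/-- A free run of duration `c` only delays the jump. Positivity of `e` matters: for `e ≤ 0` the
level time is `0`, whatever the intensity. -/
lemma levelTime_shift (h : IsIntensity φ) {c e : ℝ} (hc : 0 ≤ c) (he : 0 < e)
    (h0 : ∀ u ∈ Icc 0 c, φ u = 0) (h' : IsIntensity fun u => φ (c + u)) :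
    levelTime φ e = c + levelTime (fun u => φ (c + u)) e := by
  have hzero : ∀ r ∈ Icc 0 c, ∫ u in (0 : ℝ)..r, φ u = 0 := fun r hr => by
    rw [intervalIntegral.integral_congr (g := fun _ => (0 : ℝ)), intervalIntegral.integral_zero]
    intro u hu
    rw [uIcc_of_le hr.1] at hu
    exact h0 u ⟨hu.1, hu.2.trans hr.2⟩
  have hshift : ∀ r, ∫ u in (0 : ℝ)..(c + r), φ u = ∫ u in (0 : ℝ)..r, φ (c + u) := fun r => by
    rw [← intervalIntegral.integral_add_adjacent_intervals
      (h.continuous.intervalIntegrable 0 c) (h.continuous.intervalIntegrable c (c + r)),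
      hzero c ⟨hc, le_rfl⟩, intervalIntegral.integral_comp_add_left]
    simp
  apply le_antisymm
  · rw [h.levelTime_le_iff e (add_nonneg hc (levelTime_nonneg _ _)), hshift,
      ← h'.levelTime_le_iff e (levelTime_nonneg _ _)]
  · have hge : c ≤ levelTime φ e := by
      by_contra! hlt
      have := (h.levelTime_le_iff e (levelTime_nonneg φ e)).1 le_rfl
      rw [hzero _ ⟨levelTime_nonneg φ e, hlt.le⟩] at this
      linarith
    have : levelTime (fun u => φ (c + u)) e ≤ levelTime φ e - c := by
      rw [h'.levelTime_le_iff e (sub_nonneg.2 hge), ← hshift, add_sub_cancel,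
        ← h.levelTime_le_iff e (levelTime_nonneg _ _)]
    linarith

lemma monotone_levelTime (h : IsIntensity φ) : Monotone (levelTime φ) := fun e e' hee => by
  rw [h.levelTime_le_iff e (levelTime_nonneg _ _)]
  exact hee.trans ((h.levelTime_le_iff e' (levelTime_nonneg _ _)).1 le_rfl)

end IsIntensity

/-! ### The trajectory as a sequence of excursions from `x₀` -/

/-- A jump rate whose restriction to every ray of velocity `±1` is an intensity, which does not
charge the rays going right on the left of `x₀`, nor those going left in `[x₀, x₁]`. -/
structure IsWellRate (rate : ℝ → ℝ → ℝ) (x₀ x₁ : ℝ) : Prop where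
  lt : x₀ < x₁
  ray_left : ∀ x, IsIntensity fun u => rate (x + -1 * u) (-1)
  ray_right : ∀ x, IsIntensity fun u => rate (x + 1 * u) 1
  right_eq_zero : ∀ x ≤ x₀, rate x 1 = 0
  left_eq_zero : ∀ x ∈ Icc x₀ x₁, rate x (-1) = 0

namespace IsWellRate

variable {rate : ℝ → ℝ → ℝ} {x₀ x₁ : ℝ}

/-- The descent from `x₀ + b` to `x₀` is free, so the clock effectively starts at `x₀`. The bound on
`b` keeps the descent inside `[x₀, x₁]`, where leftward motion is not charged. -/
lemma nextJumpTime_left (h : IsWellRate rate x₀ x₁) (s : ℝ) {b e : ℝ} (hb : 0 ≤ b)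
    (hb1 : b ≤ x₁ - x₀) (he : 0 < e) :
    nextJumpTime rate s (x₀ + b) (-1) e =
      s + b + levelTime (fun u => rate (x₀ + -1 * u) (-1)) e := by
  have hfun : (fun u => rate (x₀ + b + -1 * (b + u)) (-1)) =
      fun u => rate (x₀ + -1 * u) (-1) := by
    ext u
    congr 1
    ring
  rw [nextJumpTime_eq_add_levelTime _ _ _ _ _ ((h.ray_left _).exists_level e),
    (h.ray_left _).levelTime_shift hb he, hfun, add_assoc]
  · intro u hu
    exact h.left_eq_zero _ ⟨by linarith [hu.2], by linarith [hu.1]⟩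
  · rw [hfun]
    exact h.ray_left x₀

lemma nextJumpTime_right (h : IsWellRate rate x₀ x₁) (s : ℝ) {a e : ℝ} (ha : 0 ≤ a)
    (he : 0 < e) :
    nextJumpTime rate s (x₀ - a) 1 e =
      s + a + levelTime (fun u => rate (x₀ + 1 * u) 1) e := by
  have hfun : (fun u => rate (x₀ - a + 1 * (a + u)) 1) =
      fun u => rate (x₀ + 1 * u) 1 := by
    ext u
    congr 1
    ring
  rw [nextJumpTime_eq_add_levelTime _ _ _ _ _ ((h.ray_right _).exists_level e),
    (h.ray_right _).levelTime_shift ha he, hfun, add_assoc]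
  · intro u hu
    exact h.right_eq_zero _ (by linarith [hu.2])
  · rw [hfun]
    exact h.ray_right x₀

lemma jumpSkeleton_velocity (x : ℝ) (e : ℕ → ℝ) (i : ℕ) :
    (jumpSkeleton rate (x, -1) e i).2.2 = -1 ∨ (jumpSkeleton rate (x, -1) e i).2.2 = 1 := by
  induction i with
  | zero => left; rfl
  | succ i ih =>
    simp only [jumpSkeleton]
    rcases ih with h | h <;> rw [h] <;> simp

lemma monotone_jumpSkeleton (h : IsWellRate rate x₀ x₁) (x : ℝ) (e : ℕ → ℝ) :
    Monotone fun i => (jumpSkeleton rate (x, -1) e i).1 := by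
  refine monotone_nat_of_le_succ fun i => ?_
  have key : ∀ s x' y, (y = -1 ∨ y = 1) → s ≤ nextJumpTime rate s x' y (e i) := by
    rintro s x' y (rfl | rfl)
    · rw [nextJumpTime_eq_add_levelTime _ _ _ _ _ ((h.ray_left _).exists_level _)]
      linarith [levelTime_nonneg (fun u => rate (x' + -1 * u) (-1)) (e i)]
    · rw [nextJumpTime_eq_add_levelTime _ _ _ _ _ ((h.ray_right _).exists_level _)]
      linarith [levelTime_nonneg (fun u => rate (x' + 1 * u) 1) (e i)]
  exact key _ _ _ (jumpSkeleton_velocity x e i)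

/-- Jump times are monotone, so the indices counted at time `t` form the initial segment `Iic i`,
and the `sSup` in `jumpCount` is a genuine maximum. -/
lemma velocityJumpProcess_eq (h : IsWellRate rate x₀ x₁) (x : ℝ) (e : ℕ → ℝ) {i : ℕ} {t : ℝ}
    (h1 : (jumpSkeleton rate (x, -1) e i).1 ≤ t)
    (h2 : t < (jumpSkeleton rate (x, -1) e (i + 1)).1) :
    (velocityJumpProcess rate (x, -1) e t).1 = (jumpSkeleton rate (x, -1) e i).2.1 +
      (jumpSkeleton rate (x, -1) e i).2.2 * (t - (jumpSkeleton rate (x, -1) e i).1) := by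
  have hcount : jumpCount rate (x, -1) e t = i := by
    have hset : {j : ℕ | (jumpSkeleton rate (x, -1) e j).1 ≤ t} = Iic i := by
      ext j
      simp only [mem_ofPred_eq, mem_Iic]
      constructor
      · intro hj
        by_contra! hij
        have := h.monotone_jumpSkeleton x e (Nat.succ_le_of_lt hij)
        simp only [Nat.succ_eq_add_one] at this
        linarith
      · intro hj
        exact (h.monotone_jumpSkeleton x e hj).trans h1
    rw [jumpCount, hset, csSup_Iic]
  rw [velocityJumpProcess, hcount]

/-- The duration of the first `n` excursions on both sides of `x₀`. -/
noncomputable def excursionTime (rate : ℝ → ℝ → ℝ) (x₀ : ℝ) (e : ℕ → ℝ) (n : ℕ) : ℝ :=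
  ∑ j ∈ Finset.range n, (2 * levelTime (fun u => rate (x₀ + -1 * u) (-1)) (e (2 * j)) +
    2 * levelTime (fun u => rate (x₀ + 1 * u) 1) (e (2 * j + 1)))

lemma levelTime_lt (h : IsWellRate rate x₀ x₁) {e : ℝ}
    (he : e < ∫ u in (0 : ℝ)..(x₁ - x₀), rate (x₀ + 1 * u) 1) :
    levelTime (fun u => rate (x₀ + 1 * u) 1) e < x₁ - x₀ := by
  have hc := (h.ray_right x₀).continuous_integral
  have hev : ∀ᶠ r in 𝓝[<] (x₁ - x₀), e < ∫ u in (0 : ℝ)..r, rate (x₀ + 1 * u) 1 :=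
    ((hc.tendsto _).mono_left nhdsWithin_le_nhds).eventually_const_lt he
  have hpos : ∀ᶠ r in 𝓝[<] (x₁ - x₀), 0 < r :=
    eventually_nhdsWithin_of_eventually_nhds (eventually_gt_nhds (sub_pos.2 h.lt))
  obtain ⟨r, ⟨hr1, hr2⟩, hr3⟩ := ((hev.and hpos).and self_mem_nhdsWithin).exists
  exact (((h.ray_right x₀).levelTime_le_iff e hr2.le).2 hr1.le).trans_lt hr3

/-- Each failed cycle restarts the motion from `x₀`. Only the cycles before `n` need to fail: the
turning point of cycle `n` may lie beyond `x₁`, which is what allows the use of this formula in the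
successful cycle. -/
lemma jumpSkeleton_odd_even (h : IsWellRate rate x₀ x₁) {e : ℕ → ℝ} (he : ∀ i, 0 < e i) {n : ℕ}
    (hn : ∀ j < n, e (2 * j + 1) < ∫ u in (0 : ℝ)..(x₁ - x₀), rate (x₀ + 1 * u) 1) :
    jumpSkeleton rate (x₀, -1) e (2 * n + 1) =
      (excursionTime rate x₀ e n + levelTime (fun u => rate (x₀ + -1 * u) (-1)) (e (2 * n)),
        (x₀ - levelTime (fun u => rate (x₀ + -1 * u) (-1)) (e (2 * n)), 1)) ∧
    jumpSkeleton rate (x₀, -1) e (2 * n + 2) =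
      (excursionTime rate x₀ e n + 2 * levelTime (fun u => rate (x₀ + -1 * u) (-1)) (e (2 * n)) +
        levelTime (fun u => rate (x₀ + 1 * u) 1) (e (2 * n + 1)),
        (x₀ + levelTime (fun u => rate (x₀ + 1 * u) 1) (e (2 * n + 1)), -1)) := by
  have step : ∀ n, jumpSkeleton rate (x₀, -1) e (2 * n + 1) =
      (excursionTime rate x₀ e n + levelTime (fun u => rate (x₀ + -1 * u) (-1)) (e (2 * n)),
        (x₀ - levelTime (fun u => rate (x₀ + -1 * u) (-1)) (e (2 * n)), 1)) →
    jumpSkeleton rate (x₀, -1) e (2 * n + 2) =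
      (excursionTime rate x₀ e n + 2 * levelTime (fun u => rate (x₀ + -1 * u) (-1)) (e (2 * n)) +
        levelTime (fun u => rate (x₀ + 1 * u) 1) (e (2 * n + 1)),
        (x₀ + levelTime (fun u => rate (x₀ + 1 * u) 1) (e (2 * n + 1)), -1)) := by
    intro n hodd
    rw [jumpSkeleton, hodd]
    simp only
    rw [h.nextJumpTime_right _ (levelTime_nonneg _ _) (he _)]
    ext <;> simp only <;> ring
  induction n with
  | zero =>
    have h1 : jumpSkeleton rate (x₀, -1) e (2 * 0 + 1) =
      (excursionTime rate x₀ e 0 + levelTime (fun u => rate (x₀ + -1 * u) (-1)) (e (2 * 0)),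
        (x₀ - levelTime (fun u => rate (x₀ + -1 * u) (-1)) (e (2 * 0)), 1)) := by
      rw [jumpSkeleton, jumpSkeleton]
      simp only [mul_zero]
      have := h.nextJumpTime_left 0 le_rfl (sub_nonneg.2 h.lt.le) (he 0)
      rw [add_zero] at this
      rw [this]
      simp only [excursionTime, Finset.range_zero, Finset.sum_empty]
      ext <;> simp only <;> ring
    exact ⟨h1, step 0 h1⟩
  | succ n ih =>
    have ih2 := (ih fun j hj => hn j (hj.trans (Nat.lt_succ_self n))).2
    have h1 : jumpSkeleton rate (x₀, -1) e (2 * (n + 1) + 1) =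
      (excursionTime rate x₀ e (n + 1) +
        levelTime (fun u => rate (x₀ + -1 * u) (-1)) (e (2 * (n + 1))),
        (x₀ - levelTime (fun u => rate (x₀ + -1 * u) (-1)) (e (2 * (n + 1))), 1)) := by
      rw [jumpSkeleton, show 2 * (n + 1) = 2 * n + 2 by ring, ih2]
      simp only
      rw [h.nextJumpTime_left _ (levelTime_nonneg _ _)
        (h.levelTime_lt (hn n (Nat.lt_succ_self n))).le (he _),
        excursionTime, excursionTime, Finset.sum_range_succ]
      ext <;> simp only <;> ring
    exact ⟨h1, step _ h1⟩

/-- The hitting time of `x₁` when the first clock above the height of the barrier, among those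
of the excursions to the right, is the one of index `2 n + 1`. -/
lemma firstHit_eq (h : IsWellRate rate x₀ x₁) {e : ℕ → ℝ} (he : ∀ i, 0 < e i) {n : ℕ}
    (hn : ∀ j < n, e (2 * j + 1) < ∫ u in (0 : ℝ)..(x₁ - x₀), rate (x₀ + 1 * u) 1)
    (hn' : ∫ u in (0 : ℝ)..(x₁ - x₀), rate (x₀ + 1 * u) 1 < e (2 * n + 1)) :
    firstHit (fun t => (velocityJumpProcess rate (x₀, -1) e t).1) x₁ =
      ENNReal.ofReal (excursionTime rate x₀ e n +
        2 * levelTime (fun u => rate (x₀ + -1 * u) (-1)) (e (2 * n)) + (x₁ - x₀)) := by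
  have hd : 0 < x₁ - x₀ := sub_pos.2 h.lt
  have hS : 0 ≤ excursionTime rate x₀ e n := Finset.sum_nonneg fun j _ =>
    add_nonneg (mul_nonneg zero_le_two (levelTime_nonneg _ _))
      (mul_nonneg zero_le_two (levelTime_nonneg _ _))
  have ha : 0 ≤ levelTime (fun u => rate (x₀ + -1 * u) (-1)) (e (2 * n)) := levelTime_nonneg _ _
  have hb : x₁ - x₀ < levelTime (fun u => rate (x₀ + 1 * u) 1) (e (2 * n + 1)) := by
    rw [← not_le, (h.ray_right x₀).levelTime_le_iff _ hd.le]
    exact not_le.2 hn'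
  obtain ⟨hodd, heven⟩ := h.jumpSkeleton_odd_even he hn
  refine le_antisymm ?_ ?_
  · refine iInf₂_le _ ⟨by linarith, ?_⟩
    simp only
    rw [h.velocityJumpProcess_eq x₀ e (i := 2 * n + 1)]
    · rw [hodd]
      simp only
      ring
    · rw [hodd]
      simp only
      linarith
    · rw [heven]
      simp only
      linarith
  · refine le_iInf₂ fun t ht => ENNReal.ofReal_le_ofReal ?_
    obtain ⟨ht0, ht1⟩ := ht
    by_contra! hlt
    have hlt2 : t < (jumpSkeleton rate (x₀, -1) e (2 * n + 1 + 1)).1 := by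
      rw [heven]
      simp only
      linarith
    have hex : ∃ i, t < (jumpSkeleton rate (x₀, -1) e (i + 1)).1 := ⟨_, hlt2⟩
    classical
    -- Locate the segment of the path containing `t`. Leftward segments start at or below a turning
    -- point that is `< x₁`, failed rightward ones end at such a point, and the last one has not
    -- arrived yet: none meets `x₁`.
    obtain ⟨i, hi, hmin⟩ : ∃ i, t < (jumpSkeleton rate (x₀, -1) e (i + 1)).1 ∧
        ∀ j < i, ¬ t < (jumpSkeleton rate (x₀, -1) e (j + 1)).1 :=
      ⟨Nat.find hex, Nat.find_spec hex, fun j hj => Nat.find_min hex hj⟩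
    have hin : i ≤ 2 * n + 1 := by
      by_contra! hcon
      exact hmin _ hcon hlt2
    have hlow : (jumpSkeleton rate (x₀, -1) e i).1 ≤ t := by
      cases i with
      | zero => exact ht0.le
      | succ i => exact not_lt.1 (hmin i (Nat.lt_succ_self i))
    simp only at ht1
    rw [h.velocityJumpProcess_eq x₀ e hlow hi] at ht1
    obtain ⟨k, hk | hk⟩ := Nat.even_or_odd' i
    · cases k with
      | zero =>
        subst hk
        simp only [jumpSkeleton] at ht1
        linarith
      | succ k =>
        have hkn : k < n := by omega
        have := (h.jumpSkeleton_odd_even he fun j hj => hn j (hj.trans hkn)).2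
        rw [show i = 2 * k + 2 by omega, this] at ht1 hlow
        simp only at ht1 hlow
        have := h.levelTime_lt (hn k hkn)
        linarith
    · have hkn : k ≤ n := by omega
      have hsk := h.jumpSkeleton_odd_even he fun j hj => hn j (hj.trans_le hkn)
      rw [hk, hsk.1] at ht1
      rw [hk, hsk.2] at hi
      simp only at ht1 hi
      rcases hkn.lt_or_eq with hlt' | rfl
      · have := h.levelTime_lt (hn k hlt')
        linarith
      · linarith

end IsWellRate

/-! ### Geometric sums driven by independent clocks -/

section IIDClocks

lemma Finset.prod_range_two_mul_eq {M : Type*} [CommMonoid M] (c : ℕ → M) (n : ℕ) :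
    ∏ i ∈ Finset.range (2 * n), c i = ∏ j ∈ Finset.range n, (c (2 * j) * c (2 * j + 1)) := by
  induction n with
  | zero => simp
  | succ n ih =>
    rw [Finset.prod_range_succ, ← ih, show 2 * (n + 1) = 2 * n + 1 + 1 by ring,
      Finset.prod_range_succ, Finset.prod_range_succ, mul_assoc]

/-- The sequence `u, v, …, u, v, u', v'` with `n` repetitions of `u, v`. -/
def alternating {α : Type*} (u v u' v' : α) (n i : ℕ) : α :=
  if i < 2 * n then (if Even i then u else v) else (if Even i then u' else v')

lemma alternating_mem {α : Type*} {p : α → Prop} {u v u' v' : α} (hu : p u) (hv : p v)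
    (hu' : p u') (hv' : p v') (n i : ℕ) : p (alternating u v u' v' n i) := by
  unfold alternating
  split_ifs <;> assumption

lemma prod_alternating {α M : Type*} [CommMonoid M] (φ : ℕ → α → M) (u v u' v' : α) (n : ℕ) :
    ∏ i ∈ Finset.range (2 * (n + 1)), φ i (alternating u v u' v' n i) =
      (∏ j ∈ Finset.range n, (φ (2 * j) u * φ (2 * j + 1) v)) *
        (φ (2 * n) u' * φ (2 * n + 1) v') := by
  have hodd : ∀ j, ¬ Even (2 * j + 1) := fun j => by simp
  rw [Finset.prod_range_two_mul_eq, Finset.prod_range_succ]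
  congr 1
  · refine Finset.prod_congr rfl fun j hj => ?_
    have hj := Finset.mem_range.1 hj
    simp only [alternating]
    rw [if_pos (by omega), if_pos (even_two_mul j), if_pos (by omega), if_neg (hodd j)]
  · simp only [alternating]
    rw [if_neg (by omega), if_pos (even_two_mul n), if_neg (by omega), if_neg (hodd n)]

variable {Ω : Type*} [MeasurableSpace Ω] {P : Measure Ω} {ν : Measure ℝ} {E : ℕ → Ω → ℝ}

/-- Independence factorizes a product over `n` identical cycles and a different final one;
`alternating` assigns to each clock its factor. The complex version below serves the characteristic
function. -/
lemma lintegral_prod_alternating (hE : ∀ i, Measurable (E i)) (hind : iIndepFun E P)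
    (hlaw : ∀ i, P.map (E i) = ν) {u v u' v' : ℝ → ℝ≥0∞} (hu : Measurable u) (hv : Measurable v)
    (hu' : Measurable u') (hv' : Measurable v') (n : ℕ) :
    ∫⁻ ω, (∏ j ∈ Finset.range n, (u (E (2 * j) ω) * v (E (2 * j + 1) ω))) *
        (u' (E (2 * n) ω) * v' (E (2 * n + 1) ω)) ∂P =
      ((∫⁻ x, u x ∂ν) * ∫⁻ x, v x ∂ν) ^ n * ((∫⁻ x, u' x ∂ν) * ∫⁻ x, v' x ∂ν) := by
  have hm : ∀ i, Measurable (alternating u v u' v' n i) := alternating_mem hu hv hu' hv' n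
  have key := lintegral_prod_eq_prod_lintegral_of_indepFun (Finset.range (2 * (n + 1)))
    (fun i ω => alternating u v u' v' n i (E i ω))
    (hind.comp (fun i => alternating u v u' v' n i) hm) (fun i => (hm i).comp (hE i))
  have h1 : ∀ ω, ∏ i ∈ Finset.range (2 * (n + 1)), alternating u v u' v' n i (E i ω) =
      (∏ j ∈ Finset.range n, (u (E (2 * j) ω) * v (E (2 * j + 1) ω))) *
        (u' (E (2 * n) ω) * v' (E (2 * n + 1) ω)) := fun ω =>
    prod_alternating (fun i w => w (E i ω)) u v u' v' n
  have h2 : ∀ i, ∫⁻ ω, alternating u v u' v' n i (E i ω) ∂P =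
      ∫⁻ x, alternating u v u' v' n i x ∂ν := fun i => by
    rw [← hlaw i, lintegral_map (hm i) (hE i)]
  simp only [h1, h2] at key
  rw [key, prod_alternating (fun _ w => ∫⁻ x, w x ∂ν) u v u' v' n, Finset.prod_const,
    Finset.card_range]

lemma integral_prod_alternating (hE : ∀ i, Measurable (E i)) (hind : iIndepFun E P)
    (hlaw : ∀ i, P.map (E i) = ν) {u v u' v' : ℝ → ℂ} (hu : Measurable u) (hv : Measurable v)
    (hu' : Measurable u') (hv' : Measurable v') (n : ℕ) :
    ∫ ω, (∏ j ∈ Finset.range n, (u (E (2 * j) ω) * v (E (2 * j + 1) ω))) *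
        (u' (E (2 * n) ω) * v' (E (2 * n + 1) ω)) ∂P =
      ((∫ x, u x ∂ν) * ∫ x, v x ∂ν) ^ n * ((∫ x, u' x ∂ν) * ∫ x, v' x ∂ν) := by
  have hm : ∀ i, Measurable (alternating u v u' v' n i) := alternating_mem hu hv hu' hv' n
  have hind' : iIndepFun (fun i : Fin (2 * (n + 1)) => E i) P := hind.precomp Fin.val_injective
  have key := hind'.integral_fun_prod_comp
    (f := fun i : Fin (2 * (n + 1)) => alternating u v u' v' n i)
    (fun i => (hE i).aemeasurable)
    (fun i => (hm i).aestronglyMeasurable)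
  have h1 : ∀ ω, ∏ i : Fin (2 * (n + 1)), alternating u v u' v' n i (E i ω) =
      (∏ j ∈ Finset.range n, (u (E (2 * j) ω) * v (E (2 * j + 1) ω))) *
        (u' (E (2 * n) ω) * v' (E (2 * n + 1) ω)) := fun ω => by
    rw [Fin.prod_univ_eq_prod_range (fun i => alternating u v u' v' n i (E i ω))]
    exact prod_alternating (fun i w => w (E i ω)) u v u' v' n
  have h2 : ∀ i, ∫ ω, alternating u v u' v' n i (E i ω) ∂P =
      ∫ x, alternating u v u' v' n i x ∂ν := fun i => by
    rw [← hlaw i, integral_map (hE i).aemeasurable (hm i).aestronglyMeasurable]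
  simp only [h1, h2] at key
  rw [key, Fin.prod_univ_eq_prod_range (fun i => ∫ x, alternating u v u' v' n i x ∂ν),
    prod_alternating (fun _ w => ∫ x, w x ∂ν) u v u' v' n, Finset.prod_const,
    Finset.card_range]

/-- `τ` is the total duration of a renewal process: cycles of duration `f (E (2 j)) + g (E (2 j + 1))`
are repeated as long as `E (2 j + 1) ∈ F`; the last one has duration `f (E (2 n)) + d`. -/
def IsGeometricSum (P : Measure Ω) (E : ℕ → Ω → ℝ) (F : Set ℝ) (f g : ℝ → ℝ) (d : ℝ)
    (τ : Ω → ℝ≥0∞) : Prop :=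
  ∀ᵐ ω ∂P, ∀ n, (∀ j < n, E (2 * j + 1) ω ∈ F) → E (2 * n + 1) ω ∉ F →
    τ ω = ENNReal.ofReal (∑ j ∈ Finset.range n, (f (E (2 * j) ω) + g (E (2 * j + 1) ω)) +
      f (E (2 * n) ω) + d)

/-- The event that every cycle fails has probability at most `ν F ^ n` for all `n`. -/
lemma ae_exists_notMem [IsProbabilityMeasure ν] (hE : ∀ i, Measurable (E i))
    (hind : iIndepFun E P) (hlaw : ∀ i, P.map (E i) = ν) {F : Set ℝ} (hF : MeasurableSet F)
    (hF1 : ν F < 1) :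
    ∀ᵐ ω ∂P, ∃ n, (∀ j < n, E (2 * j + 1) ω ∈ F) ∧ E (2 * n + 1) ω ∉ F := by
  have hle : ∀ n, P {ω | ∀ j, E (2 * j + 1) ω ∈ F} ≤ ν F ^ n := by
    intro n
    have hms : MeasurableSet {ω | ∀ j, E (2 * j + 1) ω ∈ F} := by
      rw [ofPred_forall]
      exact MeasurableSet.iInter fun j => hE _ hF
    have := lintegral_prod_alternating hE hind hlaw (u := 1) (v := F.indicator 1) (u' := 1)
      (v' := 1) measurable_one (measurable_one.indicator hF) measurable_one measurable_one n
    simp only [Pi.one_apply, lintegral_const, measure_univ, mul_one, one_mul,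
      lintegral_indicator_one hF] at this
    rw [← this, ← lintegral_indicator_one hms]
    refine lintegral_mono fun ω => ?_
    by_cases hω : ω ∈ {ω | ∀ j, E (2 * j + 1) ω ∈ F}
    · simp only
      rw [indicator_of_mem hω, Finset.prod_eq_one]
      · rfl
      · intro j _
        rw [indicator_of_mem (hω j)]
        rfl
    · simp only
      rw [indicator_of_notMem hω]
      exact zero_le
  have h0 : P {ω | ∀ j, E (2 * j + 1) ω ∈ F} = 0 :=
    le_antisymm (ge_of_tendsto' (ENNReal.tendsto_pow_atTop_nhds_zero_of_lt_one hF1) hle) zero_le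
  have : ∀ᵐ ω ∂P, ¬ ∀ j, E (2 * j + 1) ω ∈ F := measure_eq_zero_iff_ae_notMem.1 h0
  filter_upwards [this] with ω hω
  push Not at hω
  classical
  exact ⟨Nat.find hω, fun j hj => not_not.1 (Nat.find_min hω hj), Nat.find_spec hω⟩

/-- The series of the durations of the successive cycles. -/
noncomputable def cycleSeries (E : ℕ → Ω → ℝ) (F : Set ℝ) (f g : ℝ → ℝ) (d : ℝ) (ω : Ω) : ℝ≥0∞ :=
  -- The factor `1` gives the product the shape of `lintegral_prod_alternating` with `u = 1`. The
  -- product is the indicator that the first `k` cycles fail.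
  ∑' k, (∏ j ∈ Finset.range k, (1 * F.indicator 1 (E (2 * j + 1) ω))) *
    (ENNReal.ofReal (f (E (2 * k) ω)) + F.indicator (fun x => ENNReal.ofReal (g x))
      (E (2 * k + 1) ω) + Fᶜ.indicator (fun _ => ENNReal.ofReal d) (E (2 * k + 1) ω))

lemma measurable_cycleSeries (hE : ∀ i, Measurable (E i)) {F : Set ℝ} (hF : MeasurableSet F)
    {f g : ℝ → ℝ} (hf : Measurable f) (hg : Measurable g) (d : ℝ) :
    Measurable (cycleSeries E F f g d) := by
  refine Measurable.tsum fun k => Measurable.mul ?_ ?_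
  · exact Finset.measurable_fun_prod _ fun j _ =>
      measurable_const.mul ((measurable_one.indicator hF).comp (hE _))
  · exact ((hf.comp (hE _)).ennreal_ofReal.add ((hg.ennreal_ofReal.indicator hF).comp (hE _))).add
      ((measurable_const.indicator hF.compl).comp (hE _))

namespace IsGeometricSum

variable {F : Set ℝ} {f g : ℝ → ℝ} {d : ℝ} {τ : Ω → ℝ≥0∞}

/-- After the first success the failure product vanishes and the series terminates. This expression
makes `τ` a.e. measurable and can be integrated term by term. -/
lemma ae_eq_cycleSeries [IsProbabilityMeasure ν] (hτ : IsGeometricSum P E F f g d τ)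
    (hE : ∀ i, Measurable (E i)) (hind : iIndepFun E P) (hlaw : ∀ i, P.map (E i) = ν)
    (hF : MeasurableSet F) (hF1 : ν F < 1) (hf0 : 0 ≤ f) (hg0 : 0 ≤ g) (hd : 0 ≤ d) :
    τ =ᵐ[P] cycleSeries E F f g d := by
  filter_upwards [hτ, ae_exists_notMem hE hind hlaw hF hF1] with ω hω ⟨n, hn, hn'⟩
  rw [hω n hn hn', cycleSeries, tsum_eq_sum (s := Finset.range (n + 1)), Finset.sum_range_succ,
    ENNReal.ofReal_add _ hd, ENNReal.ofReal_add _ (hf0 _),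
    ENNReal.ofReal_sum_of_nonneg, Finset.prod_eq_one, indicator_of_notMem hn',
    indicator_of_mem (mem_compl hn'), one_mul, add_zero, add_assoc]
  · congr 1
    refine Finset.sum_congr rfl fun k hk => ?_
    have hk := Finset.mem_range.1 hk
    rw [Finset.prod_eq_one, indicator_of_mem (hn k hk), indicator_of_notMem (by simp [hn k hk]),
      one_mul, add_zero, ENNReal.ofReal_add (hf0 _) (hg0 _)]
    intro j hj
    rw [indicator_of_mem (hn j ((Finset.mem_range.1 hj).trans hk))]
    simp
  · intro j hj
    rw [indicator_of_mem (hn j (Finset.mem_range.1 hj))]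
    simp
  · exact fun j _ => add_nonneg (hf0 _) (hg0 _)
  · exact Finset.sum_nonneg fun j _ => add_nonneg (hf0 _) (hg0 _)
  · exact add_nonneg (Finset.sum_nonneg fun j _ => add_nonneg (hf0 _) (hg0 _)) (hf0 _)
  · intro k hk
    rw [Finset.mem_range, not_lt] at hk
    rw [Finset.prod_eq_zero (Finset.mem_range.2 (Nat.lt_of_succ_le hk)), zero_mul]
    rw [indicator_of_notMem hn', mul_zero]

/-- Cycle `k` takes place with probability `ν F ^ k`, independently of its own duration; the
geometric series sums to `(ν Fᶜ)⁻¹`. -/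
lemma lintegral_eq [IsProbabilityMeasure ν] (hτ : IsGeometricSum P E F f g d τ)
    (hE : ∀ i, Measurable (E i)) (hind : iIndepFun E P) (hlaw : ∀ i, P.map (E i) = ν)
    (hF : MeasurableSet F) (hF1 : ν F < 1) (hf : Measurable f) (hg : Measurable g)
    (hf0 : 0 ≤ f) (hg0 : 0 ≤ g) (hd : 0 ≤ d) :
    ∫⁻ ω, τ ω ∂P = (∫⁻ x, ENNReal.ofReal (f x) ∂ν + ∫⁻ x in F, ENNReal.ofReal (g x) ∂ν +
      ENNReal.ofReal d * ν Fᶜ) * (ν Fᶜ)⁻¹ := by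
  have hterm : ∀ (k : ℕ) {u v : ℝ → ℝ≥0∞}, Measurable u → Measurable v →
      ∫⁻ ω, (∏ j ∈ Finset.range k, (1 * F.indicator 1 (E (2 * j + 1) ω))) *
        (u (E (2 * k) ω) * v (E (2 * k + 1) ω)) ∂P =
      ν F ^ k * ((∫⁻ x, u x ∂ν) * ∫⁻ x, v x ∂ν) := fun k u v hu hv => by
    have := lintegral_prod_alternating hE hind hlaw (u := 1) (v := F.indicator 1)
      measurable_one (measurable_one.indicator hF) hu hv k
    simp only [Pi.one_apply, lintegral_const, measure_univ, mul_one,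
      lintegral_indicator_one hF] at this
    rw [this, one_mul]
  rw [lintegral_congr_ae (hτ.ae_eq_cycleSeries hE hind hlaw hF hF1 hf0 hg0 hd)]
  simp only [cycleSeries]
  rw [lintegral_tsum]
  · have hk : ∀ k, ∫⁻ ω, (∏ j ∈ Finset.range k, (1 * F.indicator 1 (E (2 * j + 1) ω))) *
        (ENNReal.ofReal (f (E (2 * k) ω)) + F.indicator (fun x => ENNReal.ofReal (g x))
        (E (2 * k + 1) ω) + Fᶜ.indicator (fun _ => ENNReal.ofReal d) (E (2 * k + 1) ω)) ∂P =
        ν F ^ k * (∫⁻ x, ENNReal.ofReal (f x) ∂ν + ∫⁻ x in F, ENNReal.ofReal (g x) ∂ν +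
          ENNReal.ofReal d * ν Fᶜ) := by
      intro k
      have h1 := hterm k hf.ennreal_ofReal (measurable_one : Measurable (1 : ℝ → ℝ≥0∞))
      have h2 := hterm k (measurable_one : Measurable (1 : ℝ → ℝ≥0∞)) (hg.ennreal_ofReal.indicator hF)
      have h3 := hterm k (measurable_one : Measurable (1 : ℝ → ℝ≥0∞))
        ((measurable_const (a := ENNReal.ofReal d)).indicator hF.compl)
      have hm : Measurable fun ω => ∏ j ∈ Finset.range k,
          (1 * F.indicator (1 : ℝ → ℝ≥0∞) (E (2 * j + 1) ω)) :=
        Finset.measurable_fun_prod _ fun j _ =>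
          measurable_const.mul ((measurable_one.indicator hF).comp (hE _))
      simp only [Pi.one_apply, lintegral_const, measure_univ, mul_one, one_mul,
        lintegral_indicator hF, lintegral_indicator hF.compl, Measure.restrict_apply,
        MeasurableSet.univ, univ_inter] at h1 h2 h3 hm ⊢
      simp only [mul_add]
      rw [lintegral_add_left, lintegral_add_left, h1, h2, h3]
      · exact hm.mul (hf.comp (hE _)).ennreal_ofReal
      · exact (hm.mul (hf.comp (hE _)).ennreal_ofReal).add
          (hm.mul ((hg.ennreal_ofReal.indicator hF).comp (hE _)))
    simp only [hk]
    rw [ENNReal.tsum_mul_right, ENNReal.tsum_geometric, mul_comm,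
      prob_compl_eq_one_sub hF]
  · intro k
    refine (Measurable.mul ?_ ?_).aemeasurable
    · exact Finset.measurable_fun_prod _ fun j _ =>
        measurable_const.mul ((measurable_one.indicator hF).comp (hE _))
    · exact ((hf.comp (hE _)).ennreal_ofReal.add
        ((hg.ennreal_ofReal.indicator hF).comp (hE _))).add
        ((measurable_const.indicator hF.compl).comp (hE _))

/-- On the event `D n` that cycle `n` is the first success, the exponential is a product of
functions of distinct clocks, with integral `(A * B) ^ n` times a constant. The series converges
since `‖A * B‖ ≤ ν.real F < 1`. -/
lemma integral_cexp_eq [IsProbabilityMeasure P] [IsProbabilityMeasure ν]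
    (hτ : IsGeometricSum P E F f g d τ)
    (hE : ∀ i, Measurable (E i)) (hind : iIndepFun E P) (hlaw : ∀ i, P.map (E i) = ν)
    (hF : MeasurableSet F) (hF1 : ν F < 1) (hf : Measurable f) (hg : Measurable g)
    (hf0 : 0 ≤ f) (hg0 : 0 ≤ g) (hd : 0 ≤ d) (s : ℝ) :
    ∫ ω, Complex.exp ((s * (τ ω).toReal : ℝ) * Complex.I) ∂P =
      (∫ x, Complex.exp ((s * f x : ℝ) * Complex.I) ∂ν) *
        (ν.real Fᶜ * Complex.exp ((s * d : ℝ) * Complex.I)) *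
      (1 - (∫ x, Complex.exp ((s * f x : ℝ) * Complex.I) ∂ν) *
        ∫ x in F, Complex.exp ((s * g x : ℝ) * Complex.I) ∂ν)⁻¹ := by
  set A : ℂ := ∫ x, Complex.exp ((s * f x : ℝ) * Complex.I) ∂ν with hA
  set B : ℂ := ∫ x in F, Complex.exp ((s * g x : ℝ) * Complex.I) ∂ν with hB
  have hnorm : ∀ r : ℝ, ‖Complex.exp (r * Complex.I)‖ = 1 := Complex.norm_exp_ofReal_mul_I
  have hAB : ‖A * B‖ < 1 := by
    have h1 : ‖A‖ ≤ 1 := by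
      refine (norm_integral_le_of_norm_le_const (C := 1)
        (Eventually.of_forall fun x => (hnorm _).le)).trans ?_
      simp
    have h2 : ‖B‖ ≤ ν.real F := by
      refine (norm_setIntegral_le_of_norm_le_const (C := 1) (measure_lt_top _ _)
        (fun x _ => (hnorm _).le)).trans ?_
      simp
    have h3 : ν.real F < 1 := by
      rw [measureReal_def, ← ENNReal.toReal_one]
      exact (ENNReal.toReal_lt_toReal (measure_ne_top _ _) ENNReal.one_ne_top).2 hF1
    rw [norm_mul]
    calc ‖A‖ * ‖B‖ ≤ 1 * ν.real F := mul_le_mul h1 h2 (norm_nonneg _) zero_le_one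
      _ < 1 := by rwa [one_mul]
  set D : ℕ → Set Ω := fun n => {ω | (∀ j < n, E (2 * j + 1) ω ∈ F) ∧ E (2 * n + 1) ω ∉ F} with hD
  have hDm : ∀ n, MeasurableSet (D n) := fun n => by
    have : D n = (⋂ j < n, E (2 * j + 1) ⁻¹' F) ∩ E (2 * n + 1) ⁻¹' Fᶜ := by
      ext ω
      simp [hD]
    rw [this]
    exact (MeasurableSet.iInter fun j => MeasurableSet.iInter fun _ => hE _ hF).inter
      (hE _ hF.compl)
  have hDd : Pairwise (Function.onFun Disjoint D) := by
    intro m n hmn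
    refine Set.disjoint_left.2 fun ω hm hn => ?_
    rcases lt_or_gt_of_ne hmn with h | h
    · exact hm.2 (hn.1 m h)
    · exact hn.2 (hm.1 n h)
  have hDu : (⋃ n, D n : Set Ω) =ᵐ[P] univ := by
    rw [eventuallyEq_univ]
    filter_upwards [ae_exists_notMem hE hind hlaw hF hF1] with ω hω
    exact mem_iUnion.2 hω
  have hτm : AEMeasurable τ P :=
    ⟨_, measurable_cycleSeries hE hF hf hg d,
      hτ.ae_eq_cycleSeries hE hind hlaw hF hF1 hf0 hg0 hd⟩
  have hint : Integrable (fun ω => Complex.exp ((s * (τ ω).toReal : ℝ) * Complex.I)) P := by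
    refine Integrable.of_bound (C := 1) ?_ (Eventually.of_forall fun ω => (hnorm _).le)
    have : AEMeasurable (fun ω => s * (τ ω).toReal) P := hτm.ennreal_toReal.const_mul s
    exact (Complex.measurable_exp.comp_aemeasurable
      ((Complex.measurable_ofReal.comp_aemeasurable this).mul_const _)).aestronglyMeasurable
  have hsum := hasSum_integral_iUnion hDm hDd hint.integrableOn (μ := P)
  rw [setIntegral_congr_set hDu, setIntegral_univ] at hsum
  have hcm : ∀ {φ : ℝ → ℝ}, Measurable φ →
      Measurable fun x => Complex.exp ((s * φ x : ℝ) * Complex.I) := fun hφ => by fun_prop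
  have hterm : ∀ n, ∫ ω in D n, Complex.exp ((s * (τ ω).toReal : ℝ) * Complex.I) ∂P =
      (A * B) ^ n * (A * (ν.real Fᶜ * Complex.exp ((s * d : ℝ) * Complex.I))) := by
    intro n
    have key := integral_prod_alternating hE hind hlaw
      (u := fun x => Complex.exp ((s * f x : ℝ) * Complex.I))
      (v := F.indicator fun x => Complex.exp ((s * g x : ℝ) * Complex.I))
      (u' := fun x => Complex.exp ((s * f x : ℝ) * Complex.I))
      (v' := Fᶜ.indicator fun _ => Complex.exp ((s * d : ℝ) * Complex.I))
      (hcm hf) ((hcm hg).indicator hF) (hcm hf) (measurable_const.indicator hF.compl) n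
    rw [integral_indicator hF, integral_indicator hF.compl, setIntegral_const,
      Complex.real_smul] at key
    rw [← key, ← integral_indicator (hDm n)]
    refine integral_congr_ae ?_
    filter_upwards [hτ] with ω hω
    by_cases hωn : ω ∈ D n
    · rw [indicator_of_mem hωn, hω n hωn.1 hωn.2, ENNReal.toReal_ofReal,
        indicator_of_mem (mem_compl hωn.2)]
      · have : ∀ j ∈ Finset.range n, Complex.exp ((s * f (E (2 * j) ω) : ℝ) * Complex.I) *
            F.indicator (fun x => Complex.exp ((s * g x : ℝ) * Complex.I)) (E (2 * j + 1) ω) =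
            Complex.exp ((s * f (E (2 * j) ω) : ℝ) * Complex.I +
              (s * g (E (2 * j + 1) ω) : ℝ) * Complex.I) := fun j hj => by
          rw [indicator_of_mem (hωn.1 j (Finset.mem_range.1 hj)), Complex.exp_add]
        rw [Finset.prod_congr rfl this, ← Complex.exp_sum, ← Complex.exp_add, ← Complex.exp_add]
        congr 1
        push_cast
        simp only [mul_add, add_mul, Finset.mul_sum, Finset.sum_mul]
        ring
      · exact add_nonneg (add_nonneg (Finset.sum_nonneg fun j _ => add_nonneg (hf0 _) (hg0 _))
          (hf0 _)) hd
    · rw [indicator_of_notMem hωn]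
      symm
      by_cases hall : ∀ j < n, E (2 * j + 1) ω ∈ F
      · have : E (2 * n + 1) ω ∈ F := by
          by_contra hcon
          exact hωn ⟨hall, hcon⟩
        rw [indicator_of_notMem (by simpa using this), mul_zero, mul_zero]
      · push Not at hall
        obtain ⟨j, hj, hjF⟩ := hall
        rw [Finset.prod_eq_zero (Finset.mem_range.2 hj), zero_mul]
        rw [indicator_of_notMem hjF, mul_zero]
  simp only [hterm] at hsum
  rw [hsum.unique ((hasSum_geometric_of_norm_lt_one hAB).mul_right _), mul_comm]

end IsGeometricSum

end IIDClocks

/-! ### Laplace's method -/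

section Laplace

/-- Provides an integrable majorant for a profile that is quadratic near `0` and linear far away. -/
lemma exp_neg_mul_min_le {c : ℝ} (u : ℝ) :
    Real.exp (-(c * min (u ^ 2) u)) ≤ Real.exp (-c * u ^ 2) + Real.exp (-c * u) := by
  rcases min_choice (u ^ 2) u with h | h <;> rw [h, ← neg_mul]
  · linarith [Real.exp_pos (-c * u)]
  · linarith [Real.exp_pos (-c * u ^ 2)]

lemma integrableOn_exp_neg_sq_add_exp_neg {c : ℝ} (hc : 0 < c) :
    IntegrableOn (fun u => Real.exp (-c * u ^ 2) + Real.exp (-c * u)) (Ioi 0) :=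
  (integrable_exp_neg_mul_sq hc).integrableOn.add (exp_neg_integrableOn_Ioi 0 hc)

/-- **Laplace's method** on the half-line, for a function with a minimum at `0`. -/
lemma tendsto_laplace {f : ℝ → ℝ} {S : Set ℝ} (hS : MeasurableSet S) (hS0 : S ⊆ Ioi 0)
    (hSn : S ∈ 𝓝[>] (0 : ℝ)) (hf : Measurable f) {c k : ℝ} (hc : 0 < c)
    (hlow : ∀ r ∈ S, c * min (r ^ 2) r ≤ f r)
    (hlim : Tendsto (fun r => f r / r ^ 2) (𝓝[>] 0) (𝓝 (k / 2))) :
    Tendsto (fun ε => (∫ r in S, Real.exp (-(f r / ε))) / √ε) (𝓝[>] 0)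
      (𝓝 (√(2 * Real.pi / k) / 2)) := by
  -- Substituting `r = √ε * u` turns the integrand into one converging pointwise to a Gaussian.
  have hscale : ∀ ε : ℝ, 0 < ε → ∫ u in Ioi 0, S.indicator (fun r => Real.exp (-(f r / ε)))
      (√ε * u) = (∫ r in S, Real.exp (-(f r / ε))) / √ε := by
    intro ε hε
    rw [integral_comp_mul_left_Ioi _ _ (Real.sqrt_pos.2 hε), mul_zero, setIntegral_indicator hS,
      inter_eq_right.2 hS0, smul_eq_mul, inv_mul_eq_div]
  have hgauss : ∫ u in Ioi (0 : ℝ), Real.exp (-(k / 2) * u ^ 2) = √(2 * Real.pi / k) / 2 := by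
    rw [integral_gaussian_Ioi]
    congr 2
    field_simp
  rw [← hgauss]
  refine Tendsto.congr' (f₁ := fun ε => ∫ u in Ioi 0,
    S.indicator (fun r => Real.exp (-(f r / ε))) (√ε * u)) ?_ ?_
  · filter_upwards [self_mem_nhdsWithin] with ε hε using hscale ε hε
  have hsqrt : Tendsto (fun ε : ℝ => √ε) (𝓝[>] 0) (𝓝[>] 0) := by
    refine tendsto_nhdsWithin_iff.2 ⟨?_, ?_⟩
    · exact (Real.continuous_sqrt.tendsto' 0 0 Real.sqrt_zero).mono_left nhdsWithin_le_nhds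
    · filter_upwards [self_mem_nhdsWithin] with ε hε using Real.sqrt_pos.2 hε
  refine tendsto_integral_filter_of_dominated_convergence
    (fun u => Real.exp (-c * u ^ 2) + Real.exp (-c * u)) ?_ ?_
    (integrableOn_exp_neg_sq_add_exp_neg hc) ?_
  · refine Eventually.of_forall fun ε => Measurable.aestronglyMeasurable ?_
    exact ((hf.div_const ε).neg.exp.indicator hS).comp (measurable_const.mul measurable_id)
  · filter_upwards [Ioo_mem_nhdsGT (zero_lt_one (α := ℝ))] with ε hε
    filter_upwards [ae_restrict_mem measurableSet_Ioi] with u hu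
    have hu : 0 < u := hu
    have hs : 0 < √ε := Real.sqrt_pos.2 hε.1
    have hs1 : √ε ≤ 1 := Real.sqrt_le_one.2 hε.2.le
    by_cases hmem : √ε * u ∈ S
    · rw [indicator_of_mem hmem, Real.norm_of_nonneg (Real.exp_pos _).le]
      refine le_trans ?_ (exp_neg_mul_min_le u)
      refine Real.exp_le_exp.2 (neg_le_neg ?_)
      rw [le_div_iff₀ hε.1]
      refine le_trans ?_ (hlow _ hmem)
      rw [mul_assoc]
      refine mul_le_mul_of_nonneg_left ?_ hc.le
      have hsq : √ε ^ 2 = ε := Real.sq_sqrt hε.1.le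
      -- For `ε ≤ 1`, `ε * min (u²) u` is below both `(√ε u)²` and `√ε u`, so the majorant does not
      -- depend on `ε`.
      refine le_min ?_ ?_
      · rw [mul_pow, hsq, mul_comm]
        exact mul_le_mul_of_nonneg_left (min_le_left _ _) hε.1.le
      · calc min (u ^ 2) u * ε ≤ u * ε := mul_le_mul_of_nonneg_right (min_le_right _ _) hε.1.le
          _ = (√ε * u) * √ε := by nth_rw 1 [← hsq]; ring
          _ ≤ (√ε * u) * 1 := mul_le_mul_of_nonneg_left hs1 (by positivity)
          _ = √ε * u := mul_one _
    · rw [indicator_of_notMem hmem, norm_zero]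
      positivity
  · filter_upwards [ae_restrict_mem measurableSet_Ioi] with u hu
    have hu : 0 < u := hu
    have hr : Tendsto (fun ε : ℝ => √ε * u) (𝓝[>] 0) (𝓝[>] 0) := by
      refine tendsto_nhdsWithin_iff.2 ⟨?_, ?_⟩
      · have := (hsqrt.mono_right nhdsWithin_le_nhds).mul_const u
        rwa [zero_mul] at this
      · filter_upwards [self_mem_nhdsWithin] with ε hε using mul_pos (Real.sqrt_pos.2 hε) hu
    have h1 := ((hlim.comp hr).mul_const (u ^ 2)).neg.rexp
    rw [← neg_mul] at h1
    refine h1.congr' ?_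
    filter_upwards [hr hSn, self_mem_nhdsWithin] with ε hmem hε
    have hε : 0 < ε := hε
    have hmem : √ε * u ∈ S := hmem
    rw [indicator_of_mem hmem]
    simp only [Function.comp]
    congr 2
    rw [mul_pow, Real.sq_sqrt hε.le]
    field_simp

lemma integrableOn_exp_neg_div {f : ℝ → ℝ} {S : Set ℝ} (hS : MeasurableSet S) (hS0 : S ⊆ Ioi 0)
    (hf : Measurable f) {c ε : ℝ} (hc : 0 < c) (hε : 0 < ε)
    (hlow : ∀ r ∈ S, c * min (r ^ 2) r ≤ f r) :
    IntegrableOn (fun r => Real.exp (-(f r / ε))) S := by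
  refine Integrable.mono' ((integrableOn_exp_neg_sq_add_exp_neg (div_pos hc hε)).mono_set hS0)
    (hf.div_const ε).neg.exp.aestronglyMeasurable ?_
  filter_upwards [ae_restrict_mem hS] with r hr
  rw [Real.norm_of_nonneg (Real.exp_pos _).le]
  refine le_trans (Real.exp_le_exp.2 (neg_le_neg ?_)) (exp_neg_mul_min_le (c := c / ε) r)
  rw [div_mul_eq_mul_div]
  exact div_le_div_of_nonneg_right (hlow r hr) hε.le

/-- The second-order limit gives a quadratic bound on some `(0, δ]`; `hlin` takes over beyond `δ`.
-/
lemma exists_mul_min_le {f : ℝ → ℝ} {S : Set ℝ} (hS0 : S ⊆ Ioi 0) (hSn : S ∈ 𝓝[>] (0 : ℝ))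
    {k : ℝ} (hk : 0 < k) (hlim : Tendsto (fun r => f r / r ^ 2) (𝓝[>] 0) (𝓝 (k / 2)))
    (hlin : ∀ δ ∈ S, 0 < f δ → ∃ c, 0 < c ∧ ∀ r ∈ S, δ ≤ r → c * r ≤ f r) :
    ∃ c, 0 < c ∧ ∀ r ∈ S, c * min (r ^ 2) r ≤ f r := by
  have hev := (hlim.eventually_const_lt (show k / 4 < k / 2 by linarith)).and hSn
  obtain ⟨δ, hδ, hsub⟩ := mem_nhdsGT_iff_exists_Ioc_subset.1 hev
  have hδ0 : 0 < δ := hδ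
  have hq : ∀ r, 0 < r → r ≤ δ → k / 4 * r ^ 2 < f r := fun r h0 h1 => by
    have := (hsub ⟨h0, h1⟩).1
    rwa [lt_div_iff₀ (by positivity)] at this
  obtain ⟨c, hc, hcr⟩ := hlin δ (hsub ⟨hδ0, le_rfl⟩).2
    (lt_trans (by positivity) (hq δ hδ0 le_rfl))
  refine ⟨min (k / 4) c, by positivity, fun r hr => ?_⟩
  have hr0 : 0 < r := hS0 hr
  have hm : 0 ≤ min (r ^ 2) r := by positivity
  rcases le_total r δ with h | h
  · calc min (k / 4) c * min (r ^ 2) r ≤ k / 4 * r ^ 2 :=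
        mul_le_mul (min_le_left _ _) (min_le_left _ _) hm (by positivity)
      _ ≤ f r := (hq r hr0 h).le
  · calc min (k / 4) c * min (r ^ 2) r ≤ c * r :=
        mul_le_mul (min_le_right _ _) (min_le_right _ _) hm hc.le
      _ ≤ f r := hcr r hr h

/-- One application of L'Hôpital's rule leaves the difference quotient of `deriv U`. As `y ^ 2 = 1`,
both sides of the well have the same curvature. -/
lemma tendsto_sub_div_sq {U : ℝ → ℝ} (hU : ContDiff ℝ 2 U) {x₀ y : ℝ} (hy : y ^ 2 = 1)
    (h0 : deriv U x₀ = 0) :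
    Tendsto (fun r => (U (x₀ + y * r) - U x₀) / r ^ 2) (𝓝[>] 0)
      (𝓝 (deriv (deriv U) x₀ / 2)) := by
  have hd : ∀ x, HasDerivAt U (deriv U x) x := fun x =>
    ((hU.differentiable (by norm_num)) x).hasDerivAt
  have hU' : ContDiff ℝ 1 (deriv U) := by
    have : ContDiff ℝ (1 + 1) U := by simpa [one_add_one_eq_two] using hU
    exact this.deriv'
  have hd2 : HasDerivAt (deriv U) (deriv (deriv U) x₀) x₀ :=
    ((hU'.differentiable (by norm_num)) x₀).hasDerivAt
  have hline : ∀ r, HasDerivAt (fun r : ℝ => x₀ + y * r) y r := fun r => by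
    simpa using ((hasDerivAt_id r).const_mul y).const_add x₀
  refine HasDerivAt.lhopital_zero_nhdsGT (f' := fun r => deriv U (x₀ + y * r) * y)
    (g' := fun r => 2 * r) ?_ ?_ ?_ ?_ ?_ ?_
  · exact Eventually.of_forall fun r => ((hd _).comp r (hline r)).sub_const _
  · refine Eventually.of_forall fun r => ?_
    simpa using hasDerivAt_pow 2 r
  · filter_upwards [self_mem_nhdsWithin] with r hr
    have : (0 : ℝ) < r := hr
    positivity
  · refine ((Continuous.tendsto' ?_ 0 0 ?_)).mono_left nhdsWithin_le_nhds
    · have := hU.continuous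
      fun_prop
    · simp
  · exact ((continuous_pow 2).tendsto' (0 : ℝ) 0 (by simp)).mono_left nhdsWithin_le_nhds
  · have hg : HasDerivAt (fun r => deriv U (x₀ + y * r)) (deriv (deriv U) x₀ * y) 0 := by
      have h2 : HasDerivAt (deriv U) (deriv (deriv U) x₀) (x₀ + y * 0) := by simpa using hd2
      exact h2.comp 0 (hline 0)
    have hs := (hasDerivAt_iff_tendsto_slope.1 hg).mono_left
      (nhdsWithin_mono (0 : ℝ) (s := Ioi 0) fun r hr => ne_of_gt hr)
    have := (hs.mul_const y).div_const 2
    rw [mul_assoc, ← sq, hy, mul_one] at this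
    refine this.congr' ?_
    filter_upwards [self_mem_nhdsWithin] with r hr
    have : (0 : ℝ) < r := hr
    simp only [slope_def_field, mul_zero, add_zero, h0, sub_zero]
    field_simp

end Laplace

/-! ### The standard exponential law -/

section Exponential

lemma expMeasure_one_eq : expMeasure 1 =
    (volume.restrict (Ioi 0)).withDensity fun x => ENNReal.ofReal (Real.exp (-x)) := by
  have : expMeasure 1 = volume.withDensity (exponentialPDF 1) := rfl
  rw [this, ← withDensity_indicator measurableSet_Ioi]
  refine withDensity_congr_ae ?_
  filter_upwards [measure_eq_zero_iff_ae_notMem.1 (measure_singleton (μ := volume) (0 : ℝ))]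
    with x hx
  rcases lt_or_gt_of_ne (show x ≠ 0 from hx) with h | h
  · rw [exponentialPDF_of_neg h, indicator_of_notMem (by simpa using h.le)]
  · rw [exponentialPDF_of_nonneg h.le, indicator_of_mem (by simpa using h)]
    simp

lemma ae_pos_expMeasure : ∀ᵐ x ∂expMeasure 1, 0 < x := by
  rw [expMeasure_one_eq]
  exact (withDensity_absolutelyContinuous _ _).ae_le (ae_restrict_mem measurableSet_Ioi)

lemma ae_ne_expMeasure (h : ℝ) : ∀ᵐ x ∂expMeasure 1, x ≠ h := by
  rw [expMeasure_one_eq]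
  refine (withDensity_absolutelyContinuous _ _).ae_le (ae_restrict_of_ae ?_)
  exact measure_eq_zero_iff_ae_notMem.1 (measure_singleton (μ := volume) h)

instance : IsProbabilityMeasure (expMeasure 1) := isProbabilityMeasure_expMeasure one_pos

lemma expMeasure_Ioi {x : ℝ} (hx : 0 ≤ x) :
    expMeasure 1 (Ioi x) = ENNReal.ofReal (Real.exp (-x)) := by
  have h := cdf_expMeasure_eq one_pos x
  rw [if_pos hx, cdf_eq_real, one_mul] at h
  rw [← ofReal_measureReal, ← compl_Iic, probReal_compl_eq_one_sub measurableSet_Iic, h]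
  congr 1
  ring

lemma expMeasure_Ici {x : ℝ} (hx : 0 ≤ x) :
    expMeasure 1 (Ici x) = ENNReal.ofReal (Real.exp (-x)) := by
  rw [← expMeasure_Ioi hx]
  refine measure_congr ?_
  filter_upwards [ae_ne_expMeasure x] with y hy
  exact propext ⟨fun h => lt_of_le_of_ne h hy.symm, fun h => le_of_lt h⟩

lemma integral_expMeasure {G : Type*} [NormedAddCommGroup G] [NormedSpace ℝ G] (f : ℝ → G) :
    ∫ x, f x ∂expMeasure 1 = ∫ x in Ioi 0, Real.exp (-x) • f x := by
  rw [expMeasure_one_eq, integral_withDensity_eq_integral_toReal_smul (by fun_prop)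
    (Eventually.of_forall fun x => ENNReal.ofReal_lt_top)]
  simp [ENNReal.toReal_ofReal (Real.exp_pos _).le]

lemma charFun_expMeasure (t : ℝ) :
    charFun (expMeasure 1) t = (1 - t * Complex.I)⁻¹ := by
  rw [charFun_apply_real, integral_expMeasure]
  have h1 : ∀ x : ℝ, Real.exp (-x) • Complex.exp (t * x * Complex.I) =
      Complex.exp ((-1 + t * Complex.I) * x) := fun x => by
    rw [Complex.real_smul, Complex.ofReal_exp, ← Complex.exp_add]
    congr 1
    push_cast
    ring
  simp only [h1]
  rw [integral_exp_mul_complex_Ioi (by simp)]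
  simp only [Complex.ofReal_zero, mul_zero, Complex.exp_zero]
  rw [neg_div, ← div_neg, one_div]
  congr 1
  ring

lemma integrable_sq_expMeasure (c : ℝ) : Integrable (fun x => (1 + c * x) ^ 2) (expMeasure 1) := by
  have hpow : ∀ n : ℕ, Integrable (fun x : ℝ => x ^ n) (expMeasure 1) := fun n => by
    rw [expMeasure_one_eq, integrable_withDensity_iff (by fun_prop)
      (Eventually.of_forall fun x => ENNReal.ofReal_lt_top)]
    have := Real.GammaIntegral_convergent (s := n + 1) (by positivity)
    refine (show IntegrableOn _ _ volume from this).congr_fun (fun x hx => ?_) measurableSet_Ioi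
    simp only [add_sub_cancel_right, Real.rpow_natCast]
    rw [ENNReal.toReal_ofReal (Real.exp_pos _).le, mul_comm]
  have := ((hpow 0).add ((hpow 1).const_mul (2 * c))).add ((hpow 2).const_mul (c ^ 2))
  refine this.congr (Eventually.of_forall fun x => ?_)
  simp only [Pi.add_apply]
  ring

end Exponential

/-! ### Level times of an exponential clock -/

namespace IsIntensity

variable {φ : ℝ → ℝ}

/-- By `levelTime_le_iff`, surviving beyond `r` means that the clock exceeds the integrated
intensity. The layer-cake formula then turns means into integrals of this tail. -/
lemma expMeasure_lt_levelTime (h : IsIntensity φ) {r : ℝ} (hr : 0 ≤ r) :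
    expMeasure 1 {x | r < levelTime φ x} =
      ENNReal.ofReal (Real.exp (-∫ u in (0 : ℝ)..r, φ u)) := by
  rw [← expMeasure_Ioi (intervalIntegral.integral_nonneg hr fun u _ => h.nonneg u)]
  congr 1
  ext x
  rw [mem_ofPred_eq, mem_Ioi, ← not_le, h.levelTime_le_iff x hr, not_le]

lemma lintegral_levelTime (h : IsIntensity φ) :
    ∫⁻ x, ENNReal.ofReal (levelTime φ x) ∂expMeasure 1 =
      ∫⁻ r in Ioi 0, ENNReal.ofReal (Real.exp (-∫ u in (0 : ℝ)..r, φ u)) := by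
  rw [lintegral_eq_lintegral_meas_lt _ (Eventually.of_forall fun x => levelTime_nonneg φ x)
    h.monotone_levelTime.measurable.aemeasurable]
  exact setLIntegral_congr_fun measurableSet_Ioi fun r hr => h.expMeasure_lt_levelTime (le_of_lt hr)

lemma lintegral_min_levelTime (h : IsIntensity φ) {d : ℝ} (hd : 0 ≤ d) :
    ∫⁻ x, ENNReal.ofReal (min (levelTime φ x) d) ∂expMeasure 1 =
      ∫⁻ r in Ioo 0 d, ENNReal.ofReal (Real.exp (-∫ u in (0 : ℝ)..r, φ u)) := by
  rw [lintegral_eq_lintegral_meas_lt _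
    (Eventually.of_forall fun x => le_min (levelTime_nonneg φ x) hd)
    (h.monotone_levelTime.measurable.min measurable_const).aemeasurable,
    ← Ioi_inter_Iio, inter_comm, ← setLIntegral_indicator measurableSet_Iio]
  refine setLIntegral_congr_fun measurableSet_Ioi fun r hr => ?_
  by_cases hrd : r < d
  · rw [indicator_of_mem (by exact hrd), ← h.expMeasure_lt_levelTime (le_of_lt hr)]
    congr 1
    ext x
    simp [hrd]
  · rw [indicator_of_notMem (by exact hrd)]
    have : {x | r < min (levelTime φ x) d} = ∅ := by
      ext x
      simp [not_lt.1 hrd]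
    rw [this, measure_empty]

end IsIntensity

/-! ### Geometry of the left well -/

namespace IsDoubleWell

variable {U : ℝ → ℝ} {x₀ x₁ x₂ : ℝ}

lemma hasDerivAt (h : IsDoubleWell U x₀ x₁ x₂) (x : ℝ) : HasDerivAt U (deriv U x) x :=
  (h.contDiff.differentiable (by norm_num) x).hasDerivAt

lemma continuous_deriv (h : IsDoubleWell U x₀ x₁ x₂) : Continuous (deriv U) :=
  h.contDiff.continuous_deriv (by norm_num)

lemma deriv_eq_zero (h : IsDoubleWell U x₀ x₁ x₂) : deriv U x₀ = 0 :=
  ((h.isLocalMin_iff x₀).2 (Or.inl rfl)).deriv_eq_zero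

lemma deriv_deriv_pos (h : IsDoubleWell U x₀ x₁ x₂) : 0 < deriv (deriv U) x₀ := by
  by_contra! hle
  have hlt := lt_of_le_of_ne hle (h.morse x₀ h.deriv_eq_zero)
  have := isLocalMax_of_deriv_deriv_neg hlt h.deriv_eq_zero h.contDiff.continuous.continuousAt
  exact h.lt_saddle.ne ((h.isLocalMax_iff x₀).1 this)

lemma deriv_nonpos (h : IsDoubleWell U x₀ x₁ x₂) {x : ℝ} (hx : x ≤ x₀) : deriv U x ≤ 0 := by
  rw [← h.deriv_eq_zero]
  exact h.convexOn_left.monotoneOn_deriv (fun x _ => (h.hasDerivAt x).differentiableAt) hx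
    self_mem_Iic hx

/-- By the Morse property a critical point is a strict second-order extremum, hence `x₀`, `x₁` or
`x₂`. -/
lemma deriv_ne_zero (h : IsDoubleWell U x₀ x₁ x₂) {x : ℝ} (hx : x ∈ Ioo x₀ x₁) :
    deriv U x ≠ 0 := by
  intro h0
  rcases lt_or_gt_of_ne (h.morse x h0) with h2 | h2
  · exact hx.2.ne ((h.isLocalMax_iff x).1
      (isLocalMax_of_deriv_deriv_neg h2 h0 h.contDiff.continuous.continuousAt))
  · rcases (h.isLocalMin_iff x).1
      (isLocalMin_of_deriv_deriv_pos h2 h0 h.contDiff.continuous.continuousAt) with rfl | rfl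
    · exact lt_irrefl _ hx.1
    · exact lt_asymm hx.2 h.saddle_lt

/-- Without zeros the derivative has constant sign, and a negative sign contradicts the minimum at
`x₀`. -/
lemma deriv_pos (h : IsDoubleWell U x₀ x₁ x₂) {x : ℝ} (hx : x ∈ Ioo x₀ x₁) : 0 < deriv U x := by
  by_contra! hle
  have hneg : ∀ y ∈ Ioo x₀ x₁, deriv U y < 0 := by
    intro y hy
    by_contra! hge
    obtain ⟨z, hz, hz0⟩ := isPreconnected_Ioo.intermediate_value hx hy
      h.continuous_deriv.continuousOn ⟨hle, hge⟩
    exact h.deriv_ne_zero hz hz0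
  have hanti : StrictAntiOn U (Icc x₀ x₁) :=
    strictAntiOn_of_deriv_neg (convex_Icc _ _) h.contDiff.continuous.continuousOn
      (by rwa [interior_Icc])
  have hmin : ∀ᶠ y in 𝓝[>] x₀, U x₀ ≤ U y :=
    eventually_nhdsWithin_of_eventually_nhds ((h.isLocalMin_iff x₀).2 (Or.inl rfl))
  obtain ⟨y, hy, hy'⟩ := (hmin.and (Ioo_mem_nhdsGT h.lt_saddle)).exists
  exact (hanti (left_mem_Icc.2 h.lt_saddle.le) ⟨hy'.1.le, hy'.2.le⟩ hy'.1).not_ge hy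

lemma strictMonoOn (h : IsDoubleWell U x₀ x₁ x₂) : StrictMonoOn U (Icc x₀ x₁) :=
  strictMonoOn_of_deriv_pos (convex_Icc _ _) h.contDiff.continuous.continuousOn fun x hx =>
    h.deriv_pos (by rwa [interior_Icc] at hx)

lemma deriv_nonneg (h : IsDoubleWell U x₀ x₁ x₂) {x : ℝ} (hx : x ∈ Icc x₀ x₁) :
    0 ≤ deriv U x := by
  refine (isClosed_Ici.preimage h.continuous_deriv).closure_subset_iff.2
    (fun y hy => (h.deriv_pos hy).le) ?_
  rwa [closure_Ioo h.lt_saddle.ne]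

lemma integral_ray (h : IsDoubleWell U x₀ x₁ x₂) (x y r : ℝ) :
    ∫ u in (0 : ℝ)..r, y * deriv U (x + y * u) = U (x + y * r) - U x := by
  have hd : ∀ u ∈ uIcc 0 r, HasDerivAt (fun u => U (x + y * u)) (y * deriv U (x + y * u)) u := by
    intro u _
    have hline : HasDerivAt (fun u : ℝ => x + y * u) y u := by
      simpa using ((hasDerivAt_id u).const_mul y).const_add x
    rw [mul_comm]
    exact (h.hasDerivAt _).comp u hline
  rw [intervalIntegral.integral_eq_sub_of_hasDerivAt hd]
  · simp
  · have := h.continuous_deriv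
    exact Continuous.intervalIntegrable (by fun_prop) _ _

/-- Dropping the positive part bounds the integrated rate below by `(U (x + y * r) - U x) / ε`,
which tends to infinity. -/
lemma isIntensity (h : IsDoubleWell U x₀ x₁ x₂) {ε : ℝ} (hε : 0 < ε) (x : ℝ) {y : ℝ}
    (hy : Tendsto (fun r => U (x + y * r)) atTop atTop) :
    IsIntensity fun u => minimalRate U ε (x + y * u) y := by
  have hc := h.continuous_deriv
  have hcont : Continuous fun u => minimalRate U ε (x + y * u) y := by
    unfold minimalRate
    fun_prop
  refine ⟨hcont, fun u => div_nonneg (le_max_right _ _) hε.le, ?_⟩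
  have hlim : Tendsto (fun r => (U (x + y * r) - U x) / ε) atTop atTop :=
    (tendsto_atTop_add_const_right _ (-U x) hy).atTop_div_const hε
  refine tendsto_atTop_mono' _ ?_ hlim
  filter_upwards [eventually_ge_atTop 0] with r hr
  rw [← h.integral_ray x y r, ← intervalIntegral.integral_div]
  refine intervalIntegral.integral_mono_on hr ?_ (hcont.intervalIntegrable _ _) fun u _ => ?_
  · exact Continuous.intervalIntegrable (by fun_prop) _ _
  · exact div_le_div_of_nonneg_right (le_max_left _ _) hε.le

lemma isWellRate (h : IsDoubleWell U x₀ x₁ x₂) {ε : ℝ} (hε : 0 < ε) :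
    IsWellRate (minimalRate U ε) x₀ x₁ where
  lt := h.lt_saddle
  ray_left x := h.isIntensity hε x (h.tendsto_atBot.comp
    (tendsto_atBot_add_const_left _ x (tendsto_id.const_mul_atTop_of_neg (by norm_num))))
  ray_right x := h.isIntensity hε x (h.tendsto_atTop.comp
    (tendsto_atTop_add_const_left _ x (tendsto_id.const_mul_atTop (by norm_num))))
  right_eq_zero x hx := by
    rw [minimalRate, max_eq_right (by linarith [h.deriv_nonpos hx]), zero_div]
  left_eq_zero x hx := by
    rw [minimalRate, max_eq_right (by linarith [h.deriv_nonneg hx]), zero_div]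

lemma integral_minimalRate (h : IsDoubleWell U x₀ x₁ x₂) (ε : ℝ) {y r : ℝ} (hr : 0 ≤ r)
    (hy : ∀ u ∈ Icc 0 r, 0 ≤ y * deriv U (x₀ + y * u)) :
    ∫ u in (0 : ℝ)..r, minimalRate U ε (x₀ + y * u) y = (U (x₀ + y * r) - U x₀) / ε := by
  rw [← h.integral_ray x₀ y r, ← intervalIntegral.integral_div]
  refine intervalIntegral.integral_congr fun u hu => ?_
  rw [uIcc_of_le hr] at hu
  simp only [minimalRate]
  rw [max_eq_left (hy u hu)]

lemma integral_minimalRate_left (h : IsDoubleWell U x₀ x₁ x₂) (ε : ℝ) {r : ℝ} (hr : 0 ≤ r) :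
    ∫ u in (0 : ℝ)..r, minimalRate U ε (x₀ + -1 * u) (-1) = (U (x₀ + -1 * r) - U x₀) / ε :=
  h.integral_minimalRate ε hr fun u hu => by
    linarith [h.deriv_nonpos (x := x₀ + -1 * u) (by linarith [hu.1])]

lemma integral_minimalRate_right (h : IsDoubleWell U x₀ x₁ x₂) (ε : ℝ) {r : ℝ} (hr : 0 ≤ r)
    (hr1 : r ≤ x₁ - x₀) :
    ∫ u in (0 : ℝ)..r, minimalRate U ε (x₀ + 1 * u) 1 = (U (x₀ + 1 * r) - U x₀) / ε :=
  h.integral_minimalRate ε hr fun u hu => by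
    linarith [h.deriv_nonneg (x := x₀ + 1 * u) ⟨by linarith [hu.1], by linarith [hu.2]⟩]

/-- Convexity makes the slope of chords issued from `x₀` nondecreasing with their length, so the
chord to `δ` supplies the linear bound. -/
lemma exists_lower_bound_left (h : IsDoubleWell U x₀ x₁ x₂) :
    ∃ c, 0 < c ∧ ∀ r ∈ Ioi (0 : ℝ), c * min (r ^ 2) r ≤ U (x₀ + -1 * r) - U x₀ := by
  refine exists_mul_min_le Subset.rfl self_mem_nhdsWithin h.deriv_deriv_pos
    (tendsto_sub_div_sq h.contDiff (by norm_num) h.deriv_eq_zero) fun δ hδ hpos => ?_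
  have hδ : 0 < δ := hδ
  refine ⟨(U (x₀ + -1 * δ) - U x₀) / δ, div_pos hpos hδ, fun r hr hδr => ?_⟩
  have hr : 0 < r := hr
  have hmem : x₀ + -1 * r ∈ Iic x₀ := mem_Iic.2 (by linarith)
  have hratio : 0 ≤ 1 - δ / r := by rw [sub_nonneg, div_le_one hr]; exact hδr
  have hconv := h.convexOn_left.2 self_mem_Iic hmem hratio (by positivity : 0 ≤ δ / r) (by ring)
  have hpt : (1 - δ / r) • x₀ + (δ / r) • (x₀ + -1 * r) = x₀ + -1 * δ := by
    simp only [smul_eq_mul]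
    field_simp
    ring
  rw [hpt] at hconv
  simp only [smul_eq_mul] at hconv
  have h2 : U (x₀ + -1 * δ) - U x₀ ≤ δ / r * (U (x₀ + -1 * r) - U x₀) := by linarith
  calc (U (x₀ + -1 * δ) - U x₀) / δ * r
      ≤ (δ / r * (U (x₀ + -1 * r) - U x₀)) / δ * r := by gcongr
    _ = U (x₀ + -1 * r) - U x₀ := by field_simp

/-- Here `U` is only increasing, but `r` is bounded by `x₁ - x₀`, so a positive constant already
dominates a multiple of `r`. -/
lemma exists_lower_bound_right (h : IsDoubleWell U x₀ x₁ x₂) :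
    ∃ c, 0 < c ∧ ∀ r ∈ Ioo 0 (x₁ - x₀), c * min (r ^ 2) r ≤ U (x₀ + 1 * r) - U x₀ := by
  have hd : 0 < x₁ - x₀ := sub_pos.2 h.lt_saddle
  refine exists_mul_min_le (fun r hr => hr.1) (Ioo_mem_nhdsGT hd) h.deriv_deriv_pos
    (tendsto_sub_div_sq h.contDiff (by norm_num) h.deriv_eq_zero) fun δ hδ hpos => ?_
  refine ⟨(U (x₀ + 1 * δ) - U x₀) / (x₁ - x₀), div_pos hpos hd, fun r hr hδr => ?_⟩
  have hmono : U (x₀ + 1 * δ) ≤ U (x₀ + 1 * r) :=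
    h.strictMonoOn.monotoneOn ⟨by linarith [hδ.1], by linarith [hδ.2]⟩
      ⟨by linarith [hr.1], by linarith [hr.2]⟩ (by linarith)
  calc (U (x₀ + 1 * δ) - U x₀) / (x₁ - x₀) * r
      ≤ (U (x₀ + 1 * δ) - U x₀) / (x₁ - x₀) * (x₁ - x₀) := by gcongr; exact hr.2.le
    _ = U (x₀ + 1 * δ) - U x₀ := by field_simp
    _ ≤ U (x₀ + 1 * r) - U x₀ := by linarith

end IsDoubleWell

/-! ### Characteristic functions and convergence in law -/

section CharFun

lemma norm_cexp_mul_I_sub_le (x : ℝ) :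
    ‖Complex.exp (x * Complex.I) - 1 - x * Complex.I‖ ≤ 3 * x ^ 2 := by
  have hn : ‖(x : ℂ) * Complex.I‖ = |x| := by simp
  rcases le_total |x| 1 with h | h
  · have := Complex.norm_exp_sub_one_sub_id_le (x := x * Complex.I) (by rwa [hn])
    rw [hn, sq_abs] at this
    nlinarith [sq_nonneg x]
  · calc ‖Complex.exp (x * Complex.I) - 1 - x * Complex.I‖
        ≤ ‖Complex.exp (x * Complex.I)‖ + ‖(1 : ℂ)‖ + ‖(x : ℂ) * Complex.I‖ :=
          (norm_sub_le _ _).trans (add_le_add_left (norm_sub_le _ _) _)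
      _ = 2 + |x| := by
          rw [Complex.norm_exp_ofReal_mul_I, hn, norm_one]
          ring
      _ ≤ 3 * x ^ 2 := by
          rw [← sq_abs x]
          nlinarith

/-- First-order expansion with an error controlled by the second moment. The measure is only finite,
in order to cover the exponential law restricted to failing clocks. -/
lemma norm_integral_cexp_sub_le {μ : Measure ℝ} [IsFiniteMeasure μ] {X : ℝ → ℝ}
    (hX : Measurable X) (hX1 : Integrable X μ) (hX2 : Integrable (fun x => X x ^ 2) μ) (s : ℝ) :
    ‖(∫ x, Complex.exp ((s * X x : ℝ) * Complex.I) ∂μ) - μ.real univ -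
      (s * ∫ x, X x ∂μ : ℝ) * Complex.I‖ ≤ 3 * (∫ x, X x ^ 2 ∂μ) * s ^ 2 := by
  have h1 : Integrable (fun x => Complex.exp ((s * X x : ℝ) * Complex.I)) μ := by
    refine Integrable.of_bound (C := 1) ?_
      (Eventually.of_forall fun x => (Complex.norm_exp_ofReal_mul_I _).le)
    exact Measurable.aestronglyMeasurable (by fun_prop)
  have h3 : Integrable (fun x => ((s * X x : ℝ) : ℂ) * Complex.I) μ :=
    ((hX1.const_mul s).ofReal).mul_const _
  have heq : (∫ x, Complex.exp ((s * X x : ℝ) * Complex.I) ∂μ) - μ.real univ -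
      (s * ∫ x, X x ∂μ : ℝ) * Complex.I =
      ∫ x, (Complex.exp ((s * X x : ℝ) * Complex.I) - 1 - (s * X x : ℝ) * Complex.I) ∂μ := by
    have h2 : Integrable (fun x => Complex.exp ((s * X x : ℝ) * Complex.I) - 1) μ :=
      h1.sub (integrable_const _)
    rw [integral_sub h2 h3, integral_sub h1 (integrable_const _),
      integral_mul_const, integral_complex_ofReal, integral_const_mul]
    simp
  rw [heq]
  refine (norm_integral_le_of_norm_le ((hX2.const_mul (3 * s ^ 2)))
    (Eventually.of_forall fun x => ?_)).trans_eq ?_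
  · exact (norm_cexp_mul_I_sub_le _).trans_eq (by ring)
  · rw [integral_const_mul]
    ring

/-- The limit of the characteristic function of a geometric sum, when the probability of success
tends to `0` and the expected duration of a cycle is of order `√ε`. -/
lemma tendsto_charFun_geometric {α β p : ℝ → ℝ} {A B : ℝ → ℂ} {d σ C t : ℝ} (hσ : 0 < σ)
    (hα : Tendsto (fun ε => α ε / √ε) (𝓝[>] 0) (𝓝 σ))
    (hβ : Tendsto (fun ε => β ε / √ε) (𝓝[>] 0) (𝓝 σ)) (hp : ∀ ε, 0 < p ε)
    (hp0 : Tendsto (fun ε => p ε / ε) (𝓝[>] 0) (𝓝 0)) {M : ℝ → ℝ}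
    (hM : ∀ ε, M ε = (2 * α ε + 2 * β ε) / p ε - d)
    (hA : ∀ᶠ ε in 𝓝[>] 0, ‖A ε - 1 - (t / M ε * (2 * α ε) : ℝ) * Complex.I‖ ≤ C * (t / M ε) ^ 2)
    (hB : ∀ᶠ ε in 𝓝[>] 0, ‖B ε - (1 - p ε : ℝ) -
      (t / M ε * (2 * (β ε - p ε * d)) : ℝ) * Complex.I‖ ≤ C * (t / M ε) ^ 2) :
    Tendsto (fun ε => M ε * p ε / √ε) (𝓝[>] 0) (𝓝 (4 * σ)) ∧
    Tendsto (fun ε => A ε * (p ε * Complex.exp ((t / M ε * d : ℝ) * Complex.I)) *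
      (1 - A ε * B ε)⁻¹) (𝓝[>] 0) (𝓝 (1 - t * Complex.I)⁻¹) := by
  have hpos : ∀ᶠ ε : ℝ in 𝓝[>] 0, 0 < ε := self_mem_nhdsWithin
  have hid : Tendsto (fun ε : ℝ => ε) (𝓝[>] 0) (𝓝 0) := nhdsWithin_le_nhds
  have hsqrt : Tendsto (fun ε : ℝ => √ε) (𝓝[>] 0) (𝓝 0) :=
    (Real.continuous_sqrt.tendsto' 0 0 Real.sqrt_zero).mono_left nhdsWithin_le_nhds
  have hps : Tendsto (fun ε => p ε / √ε) (𝓝[>] 0) (𝓝 0) := by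
    have := hp0.mul hsqrt
    rw [zero_mul] at this
    refine this.congr' ?_
    filter_upwards [hpos] with ε hε
    have h1 : 0 < √ε := Real.sqrt_pos.2 hε
    have h2 : √ε * √ε = ε := Real.mul_self_sqrt hε.le
    rw [div_mul_eq_mul_div, div_eq_div_iff hε.ne' h1.ne']
    linear_combination p ε * h2
  have hp1 : Tendsto p (𝓝[>] 0) (𝓝 0) := by
    have := hp0.mul hid
    rw [zero_mul] at this
    refine this.congr' ?_
    filter_upwards [hpos] with ε hε
    field_simp
  have hMp : Tendsto (fun ε => M ε * p ε / √ε) (𝓝[>] 0) (𝓝 (4 * σ)) := by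
    have := ((hα.const_mul 2).add (hβ.const_mul 2)).sub (hps.const_mul d)
    rw [show 2 * σ + 2 * σ - d * 0 = 4 * σ by ring] at this
    refine this.congr fun ε => ?_
    have := (hp ε).ne'
    rw [hM, sub_mul, div_mul_cancel₀ _ this]
    ring
  refine ⟨hMp, ?_⟩
  -- The frequency `t / M` is of order `p / √ε`; every later estimate is derived from this.
  have hq : Tendsto (fun ε => t / M ε * √ε / p ε) (𝓝[>] 0) (𝓝 (t / (4 * σ))) := by
    refine ((tendsto_const_nhds (x := t)).div hMp (by positivity)).congr fun ε => ?_
    simp only [Pi.div_apply]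
    rw [div_div_eq_mul_div, div_mul_eq_mul_div, div_div]
  have hs : Tendsto (fun ε => t / M ε) (𝓝[>] 0) (𝓝 0) := by
    have := hq.mul hps
    rw [mul_zero] at this
    refine this.congr' ?_
    filter_upwards [hpos] with ε hε
    have h1 : √ε ≠ 0 := (Real.sqrt_pos.2 hε).ne'
    have h2 := (hp ε).ne'
    field_simp
  -- The quotient is `C (s √ε / p)² (p / ε)` with `s = t / M`: this is where `p = o(ε)` is
  -- essential.
  have hs2 : Tendsto (fun ε => C * (t / M ε) ^ 2 / p ε) (𝓝[>] 0) (𝓝 0) := by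
    have := ((hq.pow 2).mul hp0).const_mul C
    rw [mul_zero, mul_zero] at this
    refine this.congr' ?_
    filter_upwards [hpos] with ε hε
    have h2 := (hp ε).ne'
    rw [div_pow, mul_pow, Real.sq_sqrt hε.le]
    field_simp
  have hsa : Tendsto (fun ε => t / M ε * (2 * α ε) / p ε) (𝓝[>] 0) (𝓝 (t / 2)) := by
    have := hq.mul (hα.const_mul 2)
    rw [show t / (4 * σ) * (2 * σ) = t / 2 by field_simp; norm_num] at this
    refine this.congr' ?_
    filter_upwards [hpos] with ε hε
    have h1 : √ε ≠ 0 := (Real.sqrt_pos.2 hε).ne'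
    field_simp
  have hsb : Tendsto (fun ε => t / M ε * (2 * (β ε - p ε * d)) / p ε) (𝓝[>] 0) (𝓝 (t / 2)) := by
    have := hq.mul ((hβ.sub (hps.mul_const d)).const_mul 2)
    rw [show t / (4 * σ) * (2 * (σ - 0 * d)) = t / 2 by field_simp; norm_num] at this
    refine this.congr' ?_
    filter_upwards [hpos] with ε hε
    have h1 : √ε ≠ 0 := (Real.sqrt_pos.2 hε).ne'
    field_simp
  have herr : ∀ {D : ℝ → ℂ}, (∀ᶠ ε in 𝓝[>] 0, ‖D ε‖ ≤ C * (t / M ε) ^ 2) →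
      Tendsto (fun ε => D ε / p ε) (𝓝[>] 0) (𝓝 0) := fun {D} hD => by
    refine squeeze_zero_norm' ?_ hs2
    filter_upwards [hD] with ε hε
    rw [norm_div, Complex.norm_real, Real.norm_of_nonneg (hp ε).le]
    exact div_le_div_of_nonneg_right hε (hp ε).le
  have hpc : ∀ ε, (p ε : ℂ) ≠ 0 := fun ε => Complex.ofReal_ne_zero.2 (hp ε).ne'
  have hofReal : ∀ {f : ℝ → ℝ} {a : ℝ}, Tendsto f (𝓝[>] 0) (𝓝 a) →
      Tendsto (fun ε => (f ε : ℂ)) (𝓝[>] 0) (𝓝 (a : ℂ)) := fun hf =>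
    (Complex.continuous_ofReal.tendsto _).comp hf
  have hA1 : Tendsto (fun ε => (A ε - 1) / p ε) (𝓝[>] 0) (𝓝 ((t / 2 : ℝ) * Complex.I)) := by
    have := (herr hA).add ((hofReal hsa).mul_const Complex.I)
    rw [zero_add] at this
    refine this.congr fun ε => ?_
    have := hpc ε
    push_cast
    field_simp
    ring
  have hB1 : Tendsto (fun ε => (B ε - 1) / p ε) (𝓝[>] 0)
      (𝓝 (-1 + (t / 2 : ℝ) * Complex.I)) := by
    have := ((herr hB).add ((hofReal hsb).mul_const Complex.I)).const_add (-1)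
    rw [zero_add] at this
    refine this.congr fun ε => ?_
    have := hpc ε
    push_cast
    field_simp
    ring
  have hA0 : Tendsto A (𝓝[>] 0) (𝓝 1) := by
    have := (hA1.mul (hofReal hp1)).add_const 1
    rw [Complex.ofReal_zero, mul_zero, zero_add] at this
    refine this.congr fun ε => ?_
    rw [div_mul_cancel₀ _ (hpc ε)]
    ring
  -- Written as `1 - A B = -((A - 1) + A (B - 1))`; each side of the well contributes `it/2` to the
  -- limit.
  have hD : Tendsto (fun ε => (1 - A ε * B ε) / p ε) (𝓝[>] 0) (𝓝 (1 - t * Complex.I)) := by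
    have := (hA1.add (hA0.mul hB1)).neg
    rw [show -(((t / 2 : ℝ) : ℂ) * Complex.I + 1 * (-1 + ((t / 2 : ℝ) : ℂ) * Complex.I)) =
      1 - t * Complex.I by push_cast; ring] at this
    refine this.congr fun ε => ?_
    rw [mul_div_assoc', ← add_div, ← neg_div]
    congr 1
    ring
  have hne : (1 - t * Complex.I : ℂ) ≠ 0 := fun h0 => by
    have := congrArg Complex.re h0
    simp at this
  have hexp : Tendsto (fun ε => Complex.exp ((t / M ε * d : ℝ) * Complex.I)) (𝓝[>] 0) (𝓝 1) := by
    have := ((hofReal (hs.mul_const d)).mul_const Complex.I).cexp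
    simpa using this
  have := (hA0.mul hexp).mul (hD.inv₀ hne)
  rw [one_mul, one_mul] at this
  refine this.congr fun ε => ?_
  rw [inv_div]
  ring

/-- Convergence in law to the exponential distribution, from characteristic functions. -/
lemma tendsto_measureReal_Ici_of_charFun {l : Filter ℝ} [l.IsCountablyGenerated]
    {μ : ℝ → Measure ℝ} [∀ ε, IsProbabilityMeasure (μ ε)]
    (h : ∀ t : ℝ, Tendsto (fun ε => charFun (μ ε) t) l (𝓝 (1 - t * Complex.I)⁻¹))
    {t : ℝ} (ht : 0 ≤ t) :
    Tendsto (fun ε => (μ ε).real (Ici t)) l (𝓝 (Real.exp (-t))) := by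
  -- Along a sequence, Lévy's continuity theorem gives weak convergence, and `Ici t` is a continuity
  -- set because the exponential law has no atom.
  refine tendsto_of_seq_tendsto fun x hx => ?_
  let ρ : ℕ → ProbabilityMeasure ℝ := fun n => ⟨μ (x n), inferInstance⟩
  let ρ₀ : ProbabilityMeasure ℝ := ⟨expMeasure 1, inferInstance⟩
  have hconv : Tendsto ρ atTop (𝓝 ρ₀) := by
    rw [ProbabilityMeasure.tendsto_iff_tendsto_charFun]
    intro s
    change Tendsto (fun n => charFun (μ (x n)) s) atTop (𝓝 (charFun (expMeasure 1) s))
    rw [charFun_expMeasure]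
    exact (h s).comp hx
  have hfr : (ρ₀ : Measure ℝ) (frontier (Ici t)) = 0 := by
    rw [frontier_Ici]
    exact measure_eq_zero_iff_ae_notMem.2 (ae_ne_expMeasure t)
  have := ProbabilityMeasure.tendsto_measure_of_null_frontier_of_tendsto' hconv hfr
  change Tendsto (fun n => μ (x n) (Ici t)) atTop (𝓝 (expMeasure 1 (Ici t))) at this
  rw [expMeasure_Ici ht] at this
  have h2 := (ENNReal.tendsto_toReal ENNReal.ofReal_ne_top).comp this
  rw [ENNReal.toReal_ofReal (Real.exp_pos _).le] at h2
  exact h2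

end CharFun

/-! ### Moments of the runs and exact law of the exit time -/

lemma integrable_and_integral_eq_of_lintegral_eq {α β : Type*} [MeasurableSpace α]
    [MeasurableSpace β] {μ : Measure α} {ν : Measure β} {X : α → ℝ} {g : β → ℝ}
    (hX : AEStronglyMeasurable X μ) (hX0 : 0 ≤ X) (hg : Integrable g ν) (hg0 : 0 ≤ g)
    (heq : ∫⁻ x, ENNReal.ofReal (X x) ∂μ = ∫⁻ r, ENNReal.ofReal (g r) ∂ν) :
    Integrable X μ ∧ ∫ x, X x ∂μ = ∫ r, g r ∂ν := by
  rw [← ofReal_integral_eq_lintegral_ofReal hg (Eventually.of_forall hg0)] at heq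
  refine ⟨(lintegral_ofReal_ne_top_iff_integrable hX (Eventually.of_forall hX0)).1
    (heq ▸ ENNReal.ofReal_ne_top), ?_⟩
  rw [integral_eq_lintegral_of_nonneg_ae (Eventually.of_forall hX0) hX, heq,
    ENNReal.toReal_ofReal (integral_nonneg hg0)]

/-- The duration of the run to the left of `x₀` as a function of the clock. -/
noncomputable def leftTime (U : ℝ → ℝ) (x₀ ε : ℝ) : ℝ → ℝ :=
  levelTime fun u => minimalRate U ε (x₀ + -1 * u) (-1)

/-- The duration of the run to the right of `x₀` as a function of the clock. -/
noncomputable def rightTime (U : ℝ → ℝ) (x₀ ε : ℝ) : ℝ → ℝ :=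
  levelTime fun u => minimalRate U ε (x₀ + 1 * u) 1

lemma leftTime_nonneg (U : ℝ → ℝ) (x₀ ε x : ℝ) : 0 ≤ leftTime U x₀ ε x := levelTime_nonneg _ x

lemma rightTime_nonneg (U : ℝ → ℝ) (x₀ ε x : ℝ) : 0 ≤ rightTime U x₀ ε x := levelTime_nonneg _ x

namespace IsDoubleWell

variable {U : ℝ → ℝ} {x₀ x₁ x₂ ε : ℝ}

lemma measurable_leftTime (h : IsDoubleWell U x₀ x₁ x₂) (hε : 0 < ε) :
    Measurable (leftTime U x₀ ε) :=
  ((h.isWellRate hε).ray_left x₀).monotone_levelTime.measurable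

lemma measurable_rightTime (h : IsDoubleWell U x₀ x₁ x₂) (hε : 0 < ε) :
    Measurable (rightTime U x₀ ε) :=
  ((h.isWellRate hε).ray_right x₀).monotone_levelTime.measurable

lemma measurable_profile (h : IsDoubleWell U x₀ x₁ x₂) (y : ℝ) :
    Measurable fun r => U (x₀ + y * r) - U x₀ := by
  have := h.contDiff.continuous
  exact Continuous.measurable (by fun_prop)

lemma leftTime_mean (h : IsDoubleWell U x₀ x₁ x₂) (hε : 0 < ε) :
    Integrable (leftTime U x₀ ε) (expMeasure 1) ∧ ∫ x, leftTime U x₀ ε x ∂expMeasure 1 =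
      ∫ r in Ioi 0, Real.exp (-((U (x₀ + -1 * r) - U x₀) / ε)) := by
  obtain ⟨c, hc, hlow⟩ := h.exists_lower_bound_left
  refine integrable_and_integral_eq_of_lintegral_eq
    (h.measurable_leftTime hε).aestronglyMeasurable (fun x => levelTime_nonneg _ x)
    (integrableOn_exp_neg_div measurableSet_Ioi Subset.rfl (h.measurable_profile _) hc hε hlow)
    (fun r => (Real.exp_pos _).le) ?_
  rw [leftTime, ((h.isWellRate hε).ray_left x₀).lintegral_levelTime]
  refine setLIntegral_congr_fun measurableSet_Ioi fun r hr => ?_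
  rw [h.integral_minimalRate_left ε (le_of_lt hr)]

lemma min_rightTime_mean (h : IsDoubleWell U x₀ x₁ x₂) (hε : 0 < ε) :
    Integrable (fun x => min (rightTime U x₀ ε x) (x₁ - x₀)) (expMeasure 1) ∧
    ∫ x, min (rightTime U x₀ ε x) (x₁ - x₀) ∂expMeasure 1 =
      ∫ r in Ioo 0 (x₁ - x₀), Real.exp (-((U (x₀ + 1 * r) - U x₀) / ε)) := by
  obtain ⟨c, hc, hlow⟩ := h.exists_lower_bound_right
  have hd : 0 ≤ x₁ - x₀ := sub_nonneg.2 h.lt_saddle.le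
  refine integrable_and_integral_eq_of_lintegral_eq
    ((h.measurable_rightTime hε).min measurable_const).aestronglyMeasurable
    (fun x => le_min (levelTime_nonneg _ x) hd)
    (integrableOn_exp_neg_div measurableSet_Ioo (fun r hr => hr.1) (h.measurable_profile _) hc hε
      hlow)
    (fun r => (Real.exp_pos _).le) ?_
  rw [rightTime, ((h.isWellRate hε).ray_right x₀).lintegral_min_levelTime hd]
  refine setLIntegral_congr_fun measurableSet_Ioo fun r hr => ?_
  rw [h.integral_minimalRate_right ε hr.1.le hr.2.le]

/-- The linear growth of `U` gives `leftTime ≤ 1 + x / c` for a clock `x`, uniformly in `ε ≤ 1`. The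
summand `1` places the point where `min (r²) r` is at least `x / c`. -/
lemma leftTime_sq (h : IsDoubleWell U x₀ x₁ x₂) :
    ∃ C, ∀ ε, 0 < ε → ε ≤ 1 → Integrable (fun x => leftTime U x₀ ε x ^ 2) (expMeasure 1) ∧
      ∫ x, leftTime U x₀ ε x ^ 2 ∂expMeasure 1 ≤ C := by
  obtain ⟨c, hc, hlow⟩ := h.exists_lower_bound_left
  refine ⟨∫ x, (1 + c⁻¹ * x) ^ 2 ∂expMeasure 1, fun ε hε hε1 => ?_⟩
  have hle : ∀ᵐ x ∂expMeasure 1, leftTime U x₀ ε x ^ 2 ≤ (1 + c⁻¹ * x) ^ 2 := by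
    filter_upwards [ae_pos_expMeasure] with x hx
    refine pow_le_pow_left₀ (leftTime_nonneg U x₀ ε x) ?_ 2
    have hr : 0 < 1 + c⁻¹ * x := by positivity
    rw [leftTime, ((h.isWellRate hε).ray_left x₀).levelTime_le_iff x hr.le,
      h.integral_minimalRate_left ε hr.le, le_div_iff₀ hε]
    refine le_trans ?_ (hlow _ hr)
    calc x * ε ≤ x := mul_le_of_le_one_right hx.le hε1
      _ = c * (c⁻¹ * x) := by field_simp
      _ ≤ c * min ((1 + c⁻¹ * x) ^ 2) (1 + c⁻¹ * x) := by
        refine mul_le_mul_of_nonneg_left (le_min ?_ (by linarith)) hc.le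
        nlinarith [sq_nonneg (c⁻¹ * x)]
  have hint : Integrable (fun x => leftTime U x₀ ε x ^ 2) (expMeasure 1) := by
    refine (integrable_sq_expMeasure c⁻¹).mono'
      ((h.measurable_leftTime hε).pow_const 2).aestronglyMeasurable ?_
    filter_upwards [hle] with x hx
    rwa [Real.norm_of_nonneg (sq_nonneg _)]
  exact ⟨hint, integral_mono_ae hint (integrable_sq_expMeasure c⁻¹) hle⟩

lemma barrier_pos (h : IsDoubleWell U x₀ x₁ x₂) : 0 < U x₁ - U x₀ :=
  sub_pos.2 (h.strictMonoOn (left_mem_Icc.2 h.lt_saddle.le) (right_mem_Icc.2 h.lt_saddle.le)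
    h.lt_saddle)

lemma integral_minimalRate_barrier (h : IsDoubleWell U x₀ x₁ x₂) (ε : ℝ) :
    ∫ u in (0 : ℝ)..(x₁ - x₀), minimalRate U ε (x₀ + 1 * u) 1 = (U x₁ - U x₀) / ε := by
  rw [h.integral_minimalRate_right ε (sub_nonneg.2 h.lt_saddle.le) le_rfl, one_mul,
    add_sub_cancel]

lemma rightTime_le_iff (h : IsDoubleWell U x₀ x₁ x₂) (hε : 0 < ε) (x : ℝ) :
    rightTime U x₀ ε x ≤ x₁ - x₀ ↔ x ≤ (U x₁ - U x₀) / ε := by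
  rw [rightTime, ((h.isWellRate hε).ray_right x₀).levelTime_le_iff x
    (sub_nonneg.2 h.lt_saddle.le), h.integral_minimalRate_barrier]

/-- The truncated time equals `rightTime` on failure and `x₁ - x₀` on success. This produces the
term `-(x₁ - x₀)` in `meanExit`. -/
lemma rightTime_setIntegral (h : IsDoubleWell U x₀ x₁ x₂) (hε : 0 < ε) :
    ∫ x in Iio ((U x₁ - U x₀) / ε), rightTime U x₀ ε x ∂expMeasure 1 =
      ∫ x, min (rightTime U x₀ ε x) (x₁ - x₀) ∂expMeasure 1 -
        Real.exp (-((U x₁ - U x₀) / ε)) * (x₁ - x₀) := by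
  rw [← integral_add_compl (measurableSet_Iio (a := (U x₁ - U x₀) / ε)) (h.min_rightTime_mean hε).1]
  have h1 : ∫ x in Iio ((U x₁ - U x₀) / ε), min (rightTime U x₀ ε x) (x₁ - x₀) ∂expMeasure 1 =
      ∫ x in Iio ((U x₁ - U x₀) / ε), rightTime U x₀ ε x ∂expMeasure 1 :=
    setIntegral_congr_fun measurableSet_Iio fun x hx =>
      min_eq_left ((h.rightTime_le_iff hε x).2 (le_of_lt hx))
  have h2 : ∫ x in (Iio ((U x₁ - U x₀) / ε))ᶜ, min (rightTime U x₀ ε x) (x₁ - x₀) ∂expMeasure 1 =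
      ∫ x in (Iio ((U x₁ - U x₀) / ε))ᶜ, (x₁ - x₀) ∂expMeasure 1 := by
    refine setIntegral_congr_ae measurableSet_Iio.compl ?_
    filter_upwards [ae_ne_expMeasure ((U x₁ - U x₀) / ε)] with x hx hx'
    refine min_eq_right (le_of_lt (not_le.1 fun hle => ?_))
    have hx'' : (U x₁ - U x₀) / ε ≤ x := by simpa using hx'
    exact hx (le_antisymm ((h.rightTime_le_iff hε x).1 hle) hx'')
  rw [h1, h2, setIntegral_const, compl_Iio, measureReal_def,
    expMeasure_Ici (div_pos h.barrier_pos hε).le, ENNReal.toReal_ofReal (Real.exp_pos _).le,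
    smul_eq_mul, add_sub_cancel_right]

lemma rightTime_integrableOn (h : IsDoubleWell U x₀ x₁ x₂) (hε : 0 < ε) (n : ℕ) :
    Integrable (fun x => rightTime U x₀ ε x ^ n)
      ((expMeasure 1).restrict (Iio ((U x₁ - U x₀) / ε))) ∧
    ∫ x in Iio ((U x₁ - U x₀) / ε), rightTime U x₀ ε x ^ n ∂expMeasure 1 ≤ (x₁ - x₀) ^ n := by
  have hd : 0 ≤ x₁ - x₀ := sub_nonneg.2 h.lt_saddle.le
  have hle : ∀ᵐ x ∂(expMeasure 1).restrict (Iio ((U x₁ - U x₀) / ε)),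
      ‖rightTime U x₀ ε x ^ n‖ ≤ (x₁ - x₀) ^ n := by
    filter_upwards [ae_restrict_mem measurableSet_Iio] with x hx
    rw [Real.norm_of_nonneg (pow_nonneg (rightTime_nonneg U x₀ ε x) n)]
    exact pow_le_pow_left₀ (rightTime_nonneg U x₀ ε x) ((h.rightTime_le_iff hε x).2 (le_of_lt hx)) n
  refine ⟨Integrable.of_bound ((h.measurable_rightTime hε).pow_const n).aestronglyMeasurable _ hle,
    (le_abs_self _).trans ?_⟩
  refine (norm_integral_le_of_norm_le_const hle).trans ?_
  rw [measureReal_restrict_apply_univ]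
  exact mul_le_of_le_one_right (pow_nonneg hd n) measureReal_le_one

/-- The clocks are only a.e. measurable, so they are replaced by measurable versions, which agree
with them almost surely for all indices at once. -/
lemma exists_isGeometricSum (h : IsDoubleWell U x₀ x₁ x₂) (hε : 0 < ε) {Ω : Type*}
    [MeasurableSpace Ω] {P : Measure Ω} {E : ℕ → Ω → ℝ} (hind : iIndepFun E P)
    (hlaw : ∀ i, HasLaw (E i) (expMeasure 1) P) {τ : Ω → ℝ≥0∞}
    (hτ : ∀ ω, τ ω = exitTime U x₀ x₁ ε fun i => E i ω) :
    ∃ E' : ℕ → Ω → ℝ, (∀ i, Measurable (E' i)) ∧ iIndepFun E' P ∧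
      (∀ i, P.map (E' i) = expMeasure 1) ∧
      IsGeometricSum P E' (Iio ((U x₁ - U x₀) / ε)) (fun x => 2 * leftTime U x₀ ε x)
        (fun x => 2 * rightTime U x₀ ε x) (x₁ - x₀) τ := by
  have hmk : ∀ i, E i =ᵐ[P] (hlaw i).aemeasurable.mk (E i) := fun i =>
    (hlaw i).aemeasurable.ae_eq_mk
  refine ⟨fun i => (hlaw i).aemeasurable.mk (E i), fun i => (hlaw i).aemeasurable.measurable_mk,
    hind.congr hmk, fun i => ?_, ?_⟩
  · rw [← Measure.map_congr (hmk i), (hlaw i).map_eq]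
  · have hpos : ∀ᵐ ω ∂P, ∀ i, 0 < E i ω := ae_all_iff.2 fun i =>
      ae_of_ae_map (hlaw i).aemeasurable (by rw [(hlaw i).map_eq]; exact ae_pos_expMeasure)
    -- A clock exactly equal to the barrier would turn the particle at `x₁` itself; `firstHit_eq`
    -- needs strict inequalities on both sides.
    have hne : ∀ᵐ ω ∂P, ∀ i, E i ω ≠ (U x₁ - U x₀) / ε := ae_all_iff.2 fun i =>
      ae_of_ae_map (p := fun x => x ≠ (U x₁ - U x₀) / ε) (hlaw i).aemeasurable
        (by rw [(hlaw i).map_eq]; exact ae_ne_expMeasure _)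
    filter_upwards [ae_all_iff.2 hmk, hpos, hne] with ω hω hp hn n hfail hsucc
    simp only [← hω] at hfail hsucc ⊢
    have hw := h.isWellRate hε
    rw [hτ, exitTime, hw.firstHit_eq (e := fun i => E i ω) hp (n := n)]
    · rfl
    · intro j hj
      rw [h.integral_minimalRate_barrier]
      exact hfail j hj
    · rw [h.integral_minimalRate_barrier]
      exact lt_of_le_of_ne (not_lt.1 hsucc) (hn _).symm

/-- The expectation of the exit time, see `exitTime_law`. -/
noncomputable def meanExit (U : ℝ → ℝ) (x₀ x₁ ε : ℝ) : ℝ :=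
  (2 * ∫ x, leftTime U x₀ ε x ∂expMeasure 1 +
    2 * ∫ x, min (rightTime U x₀ ε x) (x₁ - x₀) ∂expMeasure 1) /
    Real.exp (-((U x₁ - U x₀) / ε)) - (x₁ - x₀)

/-- Nonnegativity of the failed right run gives `β ≥ p d`, hence `meanExit ≥ 2d - d > 0`. -/
lemma meanExit_pos (h : IsDoubleWell U x₀ x₁ x₂) (hε : 0 < ε) : 0 < meanExit U x₀ x₁ ε := by
  have hd : 0 < x₁ - x₀ := sub_pos.2 h.lt_saddle
  have h1 : 0 ≤ ∫ x, leftTime U x₀ ε x ∂expMeasure 1 :=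
    integral_nonneg fun x => levelTime_nonneg _ x
  have h2 : 0 ≤ ∫ x in Iio ((U x₁ - U x₀) / ε), rightTime U x₀ ε x ∂expMeasure 1 :=
    integral_nonneg fun x => levelTime_nonneg _ x
  rw [h.rightTime_setIntegral hε] at h2
  have hp := Real.exp_pos (-((U x₁ - U x₀) / ε))
  rw [meanExit, sub_pos, lt_div_iff₀ hp]
  nlinarith [mul_pos hp hd]

lemma exitTime_law (h : IsDoubleWell U x₀ x₁ x₂) (hε : 0 < ε) {Ω : Type*}
    [MeasurableSpace Ω] {P : Measure Ω} [IsProbabilityMeasure P] {E : ℕ → Ω → ℝ}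
    (hind : iIndepFun E P) (hlaw : ∀ i, HasLaw (E i) (expMeasure 1) P) {τ : Ω → ℝ≥0∞}
    (hτ : ∀ ω, τ ω = exitTime U x₀ x₁ ε fun i => E i ω) :
    AEMeasurable τ P ∧ ∫⁻ ω, τ ω ∂P = ENNReal.ofReal (meanExit U x₀ x₁ ε) ∧
    ∀ s : ℝ, ∫ ω, Complex.exp ((s * (τ ω).toReal : ℝ) * Complex.I) ∂P =
      (∫ x, Complex.exp ((s * (2 * leftTime U x₀ ε x) : ℝ) * Complex.I) ∂expMeasure 1) *
        ((Real.exp (-((U x₁ - U x₀) / ε)) : ℝ) *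
          Complex.exp ((s * (x₁ - x₀) : ℝ) * Complex.I)) *
      (1 - (∫ x, Complex.exp ((s * (2 * leftTime U x₀ ε x) : ℝ) * Complex.I) ∂expMeasure 1) *
        ∫ x in Iio ((U x₁ - U x₀) / ε),
          Complex.exp ((s * (2 * rightTime U x₀ ε x) : ℝ) * Complex.I) ∂expMeasure 1)⁻¹ := by
  obtain ⟨E', hE, hind', hlaw', hsum⟩ := h.exists_isGeometricSum hε hind hlaw hτ
  have hd : 0 ≤ x₁ - x₀ := sub_nonneg.2 h.lt_saddle.le
  have hp := Real.exp_pos (-((U x₁ - U x₀) / ε))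
  have hFc : expMeasure 1 (Iio ((U x₁ - U x₀) / ε))ᶜ =
      ENNReal.ofReal (Real.exp (-((U x₁ - U x₀) / ε))) := by
    rw [compl_Iio, expMeasure_Ici (div_pos h.barrier_pos hε).le]
  have hF1 : expMeasure 1 (Iio ((U x₁ - U x₀) / ε)) < 1 := by
    refine lt_of_le_of_ne prob_le_one fun heq => ?_
    rw [(prob_compl_eq_zero_iff measurableSet_Iio).2 heq] at hFc
    exact (ENNReal.ofReal_pos.2 hp).ne hFc
  have hf := (h.measurable_leftTime hε).const_mul 2
  have hg := (h.measurable_rightTime hε).const_mul 2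
  have hf0 : 0 ≤ fun x => 2 * leftTime U x₀ ε x := fun x =>
    mul_nonneg zero_le_two (levelTime_nonneg _ x)
  have hg0 : 0 ≤ fun x => 2 * rightTime U x₀ ε x := fun x =>
    mul_nonneg zero_le_two (levelTime_nonneg _ x)
  refine ⟨⟨_, measurable_cycleSeries hE measurableSet_Iio hf hg _,
    hsum.ae_eq_cycleSeries hE hind' hlaw' measurableSet_Iio hF1 hf0 hg0 hd⟩, ?_, fun s => ?_⟩
  · have hL := (h.leftTime_mean hε).1.const_mul 2
    have hR := ((h.rightTime_integrableOn hε 1).1.congr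
      (Eventually.of_forall fun x => pow_one _)).const_mul 2
    rw [hsum.lintegral_eq hE hind' hlaw' measurableSet_Iio hF1 hf hg hf0 hg0 hd, hFc,
      ← ofReal_integral_eq_lintegral_ofReal hL (Eventually.of_forall hf0),
      ← ofReal_integral_eq_lintegral_ofReal hR (Eventually.of_forall hg0),
      ← ENNReal.ofReal_mul hd, ← ENNReal.ofReal_add (integral_nonneg hf0) (integral_nonneg hg0),
      ← ENNReal.ofReal_add (add_nonneg (integral_nonneg hf0) (integral_nonneg hg0))
        (mul_nonneg hd hp.le), ← ENNReal.ofReal_inv_of_pos hp, ← ENNReal.ofReal_mul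
        (add_nonneg (add_nonneg (integral_nonneg hf0) (integral_nonneg hg0))
        (mul_nonneg hd hp.le)), integral_const_mul, integral_const_mul,
      h.rightTime_setIntegral hε, meanExit]
    congr 1
    field_simp
    ring
  · rw [hsum.integral_cexp_eq hE hind' hlaw' measurableSet_Iio hF1 hf hg hf0 hg0 hd s,
      measureReal_def, hFc, ENNReal.toReal_ofReal hp.le]

/-! ### Asymptotics as `ε → 0` -/

lemma tendsto_leftTime_mean (h : IsDoubleWell U x₀ x₁ x₂) :
    Tendsto (fun ε => (∫ x, leftTime U x₀ ε x ∂expMeasure 1) / √ε) (𝓝[>] 0)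
      (𝓝 (√(2 * Real.pi / deriv (deriv U) x₀) / 2)) := by
  obtain ⟨c, hc, hlow⟩ := h.exists_lower_bound_left
  refine (tendsto_laplace measurableSet_Ioi Subset.rfl self_mem_nhdsWithin
    (h.measurable_profile _) hc hlow
    (tendsto_sub_div_sq h.contDiff (by norm_num) h.deriv_eq_zero)).congr' ?_
  filter_upwards [self_mem_nhdsWithin] with ε hε
  rw [(h.leftTime_mean hε).2]

lemma tendsto_min_rightTime_mean (h : IsDoubleWell U x₀ x₁ x₂) :
    Tendsto (fun ε => (∫ x, min (rightTime U x₀ ε x) (x₁ - x₀) ∂expMeasure 1) / √ε) (𝓝[>] 0)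
      (𝓝 (√(2 * Real.pi / deriv (deriv U) x₀) / 2)) := by
  obtain ⟨c, hc, hlow⟩ := h.exists_lower_bound_right
  refine (tendsto_laplace measurableSet_Ioo (fun r hr => hr.1)
    (Ioo_mem_nhdsGT (sub_pos.2 h.lt_saddle)) (h.measurable_profile _) hc hlow
    (tendsto_sub_div_sq h.contDiff (by norm_num) h.deriv_eq_zero)).congr' ?_
  filter_upwards [self_mem_nhdsWithin] with ε hε
  rw [(h.min_rightTime_mean hε).2]

lemma tendsto_charFun_exitTime (h : IsDoubleWell U x₀ x₁ x₂) (t : ℝ) :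
    Tendsto (fun ε => meanExit U x₀ x₁ ε * Real.exp (-((U x₁ - U x₀) / ε)) / √ε) (𝓝[>] 0)
      (𝓝 (4 * (√(2 * Real.pi / deriv (deriv U) x₀) / 2))) ∧
    Tendsto (fun ε =>
      (∫ x, Complex.exp ((t / meanExit U x₀ x₁ ε * (2 * leftTime U x₀ ε x) : ℝ) * Complex.I)
        ∂expMeasure 1) * ((Real.exp (-((U x₁ - U x₀) / ε)) : ℝ) *
          Complex.exp ((t / meanExit U x₀ x₁ ε * (x₁ - x₀) : ℝ) * Complex.I)) *
      (1 - (∫ x, Complex.exp ((t / meanExit U x₀ x₁ ε * (2 * leftTime U x₀ ε x) : ℝ) * Complex.I)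
        ∂expMeasure 1) * ∫ x in Iio ((U x₁ - U x₀) / ε),
          Complex.exp ((t / meanExit U x₀ x₁ ε * (2 * rightTime U x₀ ε x) : ℝ) * Complex.I)
            ∂expMeasure 1)⁻¹) (𝓝[>] 0) (𝓝 (1 - t * Complex.I)⁻¹) := by
  obtain ⟨C, hC⟩ := h.leftTime_sq
  have hk := h.deriv_deriv_pos
  have hπ := Real.pi_pos
  have hsmall : ∀ᶠ ε : ℝ in 𝓝[>] 0, 0 < ε ∧ ε ≤ 1 := by
    filter_upwards [Ioc_mem_nhdsGT (zero_lt_one (α := ℝ))] with ε hε using hε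
  refine tendsto_charFun_geometric
    (p := fun ε => Real.exp (-((U x₁ - U x₀) / ε)))
    -- The `3` comes from `norm_integral_cexp_sub_le`, the `4` from squaring the doubled run times;
    -- the two entries bound the left and the failed right runs.
    (C := max (3 * (4 * C)) (3 * (4 * (x₁ - x₀) ^ 2))) (by positivity) h.tendsto_leftTime_mean
    h.tendsto_min_rightTime_mean (fun ε => Real.exp_pos _) ?_ (fun ε => rfl) ?_ ?_
  -- With `x = ε⁻¹`, `p / ε` reads `x * exp (-h x)`.
  · have hinv : Tendsto (fun ε : ℝ => ε⁻¹) (𝓝[>] 0) atTop := tendsto_inv_nhdsGT_zero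
    have := (tendsto_rpow_mul_exp_neg_mul_atTop_nhds_zero 1 _ h.barrier_pos).comp hinv
    refine this.congr fun ε => ?_
    simp only [Function.comp, Real.rpow_one]
    rw [div_eq_inv_mul, neg_mul, div_eq_mul_inv]
  · filter_upwards [hsmall] with ε hε
    have key := norm_integral_cexp_sub_le (μ := expMeasure 1)
      ((h.measurable_leftTime hε.1).const_mul 2) ((h.leftTime_mean hε.1).1.const_mul 2)
      (((hC ε hε.1 hε.2).1.const_mul 4).congr
        (Eventually.of_forall fun x => by simp only; ring)) (t / meanExit U x₀ x₁ ε)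
    rw [integral_const_mul, probReal_univ, Complex.ofReal_one] at key
    refine key.trans (mul_le_mul_of_nonneg_right (le_max_of_le_left ?_) (sq_nonneg _))
    simp only [mul_pow, integral_const_mul]
    linarith [(hC ε hε.1 hε.2).2]
  · filter_upwards [hsmall] with ε hε
    have hR := h.rightTime_integrableOn hε.1
    have key := norm_integral_cexp_sub_le
      (μ := (expMeasure 1).restrict (Iio ((U x₁ - U x₀) / ε)))
      ((h.measurable_rightTime hε.1).const_mul 2)
      (((hR 1).1.const_mul 2).congr (Eventually.of_forall fun x => by simp only; ring))
      (((hR 2).1.const_mul 4).congr (Eventually.of_forall fun x => by simp only; ring))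
      (t / meanExit U x₀ x₁ ε)
    have hF : (expMeasure 1).real (Iio ((U x₁ - U x₀) / ε)) =
        1 - Real.exp (-((U x₁ - U x₀) / ε)) := by
      rw [← compl_Ici, probReal_compl_eq_one_sub measurableSet_Ici, measureReal_def,
        expMeasure_Ici (div_pos h.barrier_pos hε.1).le,
        ENNReal.toReal_ofReal (Real.exp_pos _).le]
    rw [integral_const_mul, measureReal_restrict_apply_univ, hF,
      h.rightTime_setIntegral hε.1] at key
    refine key.trans (mul_le_mul_of_nonneg_right (le_max_of_le_right ?_) (sq_nonneg _))
    simp only [mul_pow, integral_const_mul]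
    linarith [(hR 2).2]

lemma isEquivalent_meanExit (h : IsDoubleWell U x₀ x₁ x₂) :
    Asymptotics.IsEquivalent (𝓝[>] (0 : ℝ)) (meanExit U x₀ x₁)
      (fun ε => √(8 * Real.pi * ε / deriv (deriv U) x₀) * Real.exp ((U x₁ - U x₀) / ε)) := by
  have hk := h.deriv_deriv_pos
  have hπ := Real.pi_pos
  have h8 : 4 * (√(2 * Real.pi / deriv (deriv U) x₀) / 2) =
      √(8 * Real.pi / deriv (deriv U) x₀) := by
    rw [show 8 * Real.pi / deriv (deriv U) x₀ = 2 ^ 2 * (2 * Real.pi / deriv (deriv U) x₀) by ring,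
      Real.sqrt_mul (by positivity), Real.sqrt_sq zero_le_two]
    ring
  have hpos : 0 < √(8 * Real.pi / deriv (deriv U) x₀) := by positivity
  -- The first component does not involve `t`; the value `0` is arbitrary.
  have hlim := (h.tendsto_charFun_exitTime 0).1.div_const (√(8 * Real.pi / deriv (deriv U) x₀))
  rw [h8, div_self hpos.ne'] at hlim
  refine Asymptotics.isEquivalent_of_tendsto_one (hlim.congr' ?_)
  filter_upwards [self_mem_nhdsWithin] with ε hε
  have hε : 0 < ε := hε
  have hs : 0 < √ε := Real.sqrt_pos.2 hε
  simp only [Pi.div_apply]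
  rw [Real.exp_neg, show 8 * Real.pi * ε / deriv (deriv U) x₀ =
    8 * Real.pi / deriv (deriv U) x₀ * ε by ring, Real.sqrt_mul (by positivity)]
  have := Real.exp_pos ((U x₁ - U x₀) / ε)
  field_simp

end IsDoubleWell

/-! ### Conclusion -/

theorem mainTheorem1
    (U : ℝ → ℝ) (x₀ x₁ x₂ : ℝ) (hU : IsDoubleWell U x₀ x₁ x₂)
    {Ω : ℝ → Type*} [∀ ε, MeasurableSpace (Ω ε)] (P : ∀ ε, Measure (Ω ε))
    (hP : ∀ ε, 0 < ε → IsProbabilityMeasure (P ε))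
    (E : ∀ ε, ℕ → Ω ε → ℝ)
    (hE_indep : ∀ ε, 0 < ε → iIndepFun (E ε) (P ε))
    (hE_law : ∀ ε, 0 < ε → ∀ i, HasLaw (E ε i) (expMeasure 1) (P ε))
    (τ : ∀ ε, Ω ε → ℝ≥0∞)
    (hτ : ∀ ε, 0 < ε → ∀ ω, τ ε ω = exitTime U x₀ x₁ ε (fun i => E ε i ω)) :
    (∀ ε, 0 < ε → AEMeasurable (τ ε) (P ε) ∧ ∫⁻ ω, τ ε ω ∂(P ε) ≠ ∞) ∧
    Asymptotics.IsEquivalent (𝓝[>] (0 : ℝ))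
      (fun ε => (∫⁻ ω, τ ε ω ∂(P ε)).toReal)
      (fun ε => √(8 * Real.pi * ε / deriv (deriv U) x₀) * Real.exp ((U x₁ - U x₀) / ε)) ∧
    ∀ t : ℝ, 0 ≤ t →
      Tendsto (fun ε => (P ε).real {ω | ENNReal.ofReal t * ∫⁻ ω', τ ε ω' ∂(P ε) ≤ τ ε ω})
        (𝓝[>] 0) (𝓝 (Real.exp (-t))) := by
  have hlaw := fun (ε : ℝ) (hε : 0 < ε) =>
    haveI := hP ε hε
    hU.exitTime_law hε (hE_indep ε hε) (hE_law ε hε) (hτ ε hε)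
  have hfin : ∀ ε : ℝ, 0 < ε → ∫⁻ ω, τ ε ω ∂(P ε) ≠ ∞ := fun ε hε => by
    rw [(hlaw ε hε).2.1]
    exact ENNReal.ofReal_ne_top
  refine ⟨fun ε hε => ⟨(hlaw ε hε).1, hfin ε hε⟩, ?_, fun t ht => ?_⟩
  · refine hU.isEquivalent_meanExit.congr_left ?_
    filter_upwards [self_mem_nhdsWithin] with ε hε
    rw [(hlaw ε hε).2.1, ENNReal.toReal_ofReal (hU.meanExit_pos hε).le]
  · let X : ∀ ε, Ω ε → ℝ := fun ε ω => (τ ε ω).toReal / IsDoubleWell.meanExit U x₀ x₁ ε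
    have hX : ∀ ε, 0 < ε → AEMeasurable (X ε) (P ε) := fun ε hε =>
      (hlaw ε hε).1.ennreal_toReal.div_const _
    -- The law of `τ / 𝔼 τ`, completed by a Dirac mass for `ε ≤ 0` so that every `μ ε` is a
    -- probability measure.
    let μ : ℝ → Measure ℝ := fun ε => if 0 < ε then (P ε).map (X ε) else Measure.dirac 0
    have hμ : ∀ ε, 0 < ε → μ ε = (P ε).map (X ε) := fun ε hε => if_pos hε
    have hμp : ∀ ε, IsProbabilityMeasure (μ ε) := fun ε => by
      by_cases hε : 0 < ε
      · rw [hμ ε hε]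
        have := hP ε hε
        exact Measure.isProbabilityMeasure_map (hX ε hε)
      · simp only [μ, if_neg hε]
        infer_instance
    refine (tendsto_measureReal_Ici_of_charFun (μ := μ) (fun s => ?_) ht).congr' ?_
    · refine (hU.tendsto_charFun_exitTime s).2.congr' ?_
      filter_upwards [self_mem_nhdsWithin] with ε hε
      rw [← (hlaw ε hε).2.2, charFun_apply_real, hμ ε hε, integral_map (hX ε hε)
        (Measurable.aestronglyMeasurable (by fun_prop))]
      refine integral_congr_ae (Eventually.of_forall fun ω => ?_)
      simp only [X]
      congr 2
      push_cast
      ring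
    · filter_upwards [self_mem_nhdsWithin] with ε hε
      have hM := hU.meanExit_pos hε
      rw [hμ ε hε, measureReal_def, measureReal_def,
        Measure.map_apply_of_aemeasurable (hX ε hε) measurableSet_Ici, (hlaw ε hε).2.1]
      congr 1
      refine measure_congr ?_
      -- Finiteness of `τ` is needed here: `toReal` sends `∞` to `0`, which would break the
      -- equivalence.
      filter_upwards [ae_lt_top' (hlaw ε hε).1 (hfin ε hε)] with ω hω
      refine propext ?_
      change t ≤ (τ ε ω).toReal / IsDoubleWell.meanExit U x₀ x₁ ε ↔
        ENNReal.ofReal t * ENNReal.ofReal (IsDoubleWell.meanExit U x₀ x₁ ε) ≤ τ ε ω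
      rw [← ENNReal.ofReal_mul ht, ENNReal.ofReal_le_iff_le_toReal hω.ne, le_div_iff₀ hM]
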